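/- **Theorem (basic Bott–Chern exact sequence).** Let $\mathcal M$ be a smooth manifold with a transversally holomorphic foliation $\mathcal F$ of complex codimension $n$. That is, there are an open cover $\{U_i\}$ of $\mathcal M$, smooth submersions $\varphi_i:U_i\to N$ to an $n$-dimensional complex manifold $N$, and holomorphic maps $f_{ij}:\varphi_i(U_i\cap U_j)\to\varphi_j(U_i\cap U_j)$ with $\varphi_j=f_{ij}\circ\varphi_i$ on $U_i\cap U_j$; the tangent bundle $T\mathcal F$ is $\ker d\varphi_i$ on $U_i$, and the normal bundle $Q=T\mathcal M/T\mathcal F$ carries the complex structure induced by the isomorphisms $d\varphi_i:Q_x\cong T_{\varphi_i(x)}N$. Forms are smooth and complex valued. A form $\varphi$ is basic if $i_X\varphi=0$ and $\mathcal L_X\varphi=0$ (equivalently $i_X\varphi=0$ and $i_Xd\varphi=0$) for all $X$ tangent to $\mathcal F$; $\Omega^r(\mathcal M/\mathcal F)$ is the space of basic $r$-forms, and $d_b$ is the restriction of $d$ to basic forms. Let $\theta$ be a real $d$-closed basic $1$-form, and let $E=\mathcal M\times\mathbb C$ be the complexification of the trivial real foliated line bundle with flat basic connection $d_b-\theta$.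 Put $\nabla=d-\theta\wedge$. Let $\Omega^{p,q}(\mathcal M/\mathcal F,E)$ be the space of $(p+q)$-forms $\varphi$ with $i_X\varphi=0=i_X\nabla\varphi$ for all $X$ tangent to $\mathcal F$ whose values lie in $\Lambda^p(Q^{1,0})^*\otimes\Lambda^q(Q^{0,1})^*$, and let $\partial_{b,E}$ and $\bar\partial_{b,E}$ be the components of $\nabla$ of bidegree $(1,0)$ and $(0,1)$. Consider the complex vector spaces $$H^1(\mathcal M/\mathcal F,\mathcal E)=\frac{\ker(\bar\partial_{b,E}:\Omega^{0,1}(\mathcal M/\mathcal F,E)\to\Omega^{0,2}(\mathcal M/\mathcal F,E))}{\bar\partial_{b,E}\,\Omega^{0,0}(\mathcal M/\mathcal F,E)},\qquad H^{1,1}_{BC}(\mathcal M/\mathcal F,E)=\frac{\{\eta\in\Omega^{1,1}(\mathcal M/\mathcal F,E):\partial_{b,E}\eta=0=\bar\partial_{b,E}\eta\}}{\partial_{b,E}\bar\partial_{b,E}\,\Omega^{0,0}(\mathcal M/\mathcal F,E)},$$ $$H^2_\theta(\mathcal M/\mathcal F)=\frac{\ker(d_b-\theta\wedge:\Omega^2(\mathcal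 M/\mathcal F)\to\Omega^3(\mathcal M/\mathcal F))}{(d_b-\theta\wedge)\,\Omega^1(\mathcal M/\mathcal F)} .$$ Then: 1. Complex conjugation of forms, $[\alpha]\mapsto[\bar\alpha]$, induces a $\mathbb C$-linear isomorphism $\kappa$ from the complex conjugate vector space $\overline{H^1(\mathcal M/\mathcal F,\mathcal E)}$ onto the first cohomology of the complex $(\Omega^{\bullet,0}(\mathcal M/\mathcal F,E),\partial_{b,E})$. 2. There are well-defined $\mathbb C$-linear maps $$\partial^*_{b,E}:H^1(\mathcal M/\mathcal F,\mathcal E)\to H^{1,1}_{BC}(\mathcal M/\mathcal F,E),\quad[\alpha]\mapsto[\partial_{b,E}\alpha],$$ $$\bar\partial^*_{b,E}:\overline{H^1(\mathcal M/\mathcal F,\mathcal E)}\to H^{1,1}_{BC}(\mathcal M/\mathcal F,E),\quad\kappa^{-1}[\beta]\mapsto[\bar\partial_{b,E}\beta]\quad(\beta\in\Omega^{1,0}(\mathcal M/\mathcal F,E),\ \partial_{b,E}\beta=0),$$ and a well-defined $\mathbb C$-linear tautological map $\nu:H^{1,1}_{BC}(\mathcal M/\mathcal F,E)\to H^2_\theta(\mathcal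 M/\mathcal F)$, $[\eta]\mapsto[\eta]$. 3. With these maps the sequence $$H^1(\mathcal M/\mathcal F,\mathcal E)\oplus\overline{H^1(\mathcal M/\mathcal F,\mathcal E)}\xrightarrow{\ \partial^*_{b,E}+\bar\partial^*_{b,E}\ }H^{1,1}_{BC}(\mathcal M/\mathcal F,E)\xrightarrow{\ \nu\ }H^2_\theta(\mathcal M/\mathcal F)$$ is exact. -/

import Mathlib

open scoped Manifold ContDiff

noncomputable section

/-- The real model space of a `d`-dimensional manifold. -/
abbrev RModel (d : ℕ) := EuclideanSpace ℝ (Fin d)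

/-- The model space of an `n`-dimensional complex manifold. -/
abbrev CModel (n : ℕ) := EuclideanSpace ℂ (Fin n)

/-! ### Complex valued differential forms on a manifold -/

set_option linter.unusedSectionVars false

section Forms

variable {d : ℕ} {M : Type*} [TopologicalSpace M] [ChartedSpace (RModel d) M]

/-- Arbitrary (not necessarily smooth) complex valued `r`-forms on `M`. The value at `x` is a real
alternating form on `T_x M`; recall that `TangentSpace 𝓘(ℝ, RModel d) x` is `RModel d`, identified
by means of the preferred chart at `x`. -/
def DForm (d : ℕ) (M : Type*) (r : ℕ) := M → RModel d [⋀^Fin r]→L[ℝ] ℂ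

namespace DForm

variable {r : ℕ}

instance : AddCommGroup (DForm d M r) :=
  inferInstanceAs (AddCommGroup (M → RModel d [⋀^Fin r]→L[ℝ] ℂ))

instance : Module ℂ (DForm d M r) :=
  inferInstanceAs (Module ℂ (M → RModel d [⋀^Fin r]→L[ℝ] ℂ))

@[ext] lemma ext {φ ψ : DForm d M r} (h : ∀ x v, φ x v = ψ x v) : φ = ψ :=
  funext fun x => ContinuousAlternatingMap.ext (h x)

@[simp] lemma add_apply (φ ψ : DForm d M r) (x : M) : (φ + ψ) x = φ x + ψ x := rfl

@[simp] lemma sub_apply (φ ψ : DForm d M r) (x : M) : (φ - ψ) x = φ x - ψ x := rfl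

@[simp] lemma neg_apply (φ : DForm d M r) (x : M) : (-φ) x = -φ x := rfl

@[simp] lemma zero_apply (x : M) : (0 : DForm d M r) x = 0 := rfl

@[simp] lemma smul_apply (c : ℂ) (φ : DForm d M r) (x : M) : (c • φ) x = c • φ x := rfl

end DForm

/-- The derivative at `y` of the inverse of the preferred chart at `x₀`. -/
def chartInvDeriv (d : ℕ) {M : Type*} [TopologicalSpace M] [ChartedSpace (RModel d) M]
    (x₀ : M) (y : RModel d) : RModel d →L[ℝ] RModel d :=
  mfderiv 𝓘(ℝ, RModel d) 𝓘(ℝ, RModel d) (extChartAt 𝓘(ℝ, RModel d) x₀).symm y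

/-- The expression of `φ` in the preferred chart at `x₀`: its pullback under the inverse chart. -/
def DForm.inChart {r : ℕ} (φ : DForm d M r) (x₀ : M) : RModel d → RModel d [⋀^Fin r]→L[ℝ] ℂ :=
  fun y => (φ ((extChartAt 𝓘(ℝ, RModel d) x₀).symm y)).compContinuousLinearMap
    (chartInvDeriv d x₀ y)

/-- `φ` is smooth: its expression in each chart is smooth. -/
def DForm.IsSmooth {r : ℕ} (φ : DForm d M r) : Prop :=
  ∀ x₀ : M, ContDiffOn ℝ ∞ (φ.inChart x₀) (extChartAt 𝓘(ℝ, RModel d) x₀).target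

/-- The exterior derivative, computed at `x` in the preferred chart at `x` (whose inverse has
derivative the identity at the image of `x`, for the identification of `T_x M` with the model). -/
def DForm.extD {r : ℕ} (φ : DForm d M r) : DForm d M (r + 1) :=
  fun x => extDeriv (φ.inChart x) (extChartAt 𝓘(ℝ, RModel d) x x)

/-- The exterior product `θ ∧ φ` of a `1`-form with an `r`-form:
`(θ ∧ φ)(v₀, …, v_r) = ∑ k, (-1)^k θ(v_k) φ(v₀, …, v_r without v_k)`. -/
def DForm.wedge {r : ℕ} (θ : DForm d M 1) (φ : DForm d M r) : DForm d M (r + 1) :=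
  fun x => ContinuousAlternatingMap.alternatizeUncurryFin
    (((ContinuousAlternatingMap.ofSubsingleton ℝ (RModel d) ℂ (0 : Fin 1)).symm (θ x)).smulRight
      (φ x))

/-- The complex conjugate of a form. -/
def DForm.conj {r : ℕ} (φ : DForm d M r) : DForm d M r :=
  fun x => (Complex.conjCLE : ℂ →L[ℝ] ℂ).compContinuousAlternatingMap (φ x)

/-- The operator `∇ = d - θ ∧`. It is the Lichnerowicz differential `d_θ`, and also the exterior
covariant derivative of the connection `d - θ` on the trivial complex line bundle `E = M × ℂ`, whose
`E`-valued forms are the complex valued forms. -/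
def DForm.nabla {r : ℕ} (θ : DForm d M 1) (φ : DForm d M r) : DForm d M (r + 1) :=
  φ.extD - θ.wedge φ

lemma DForm.inChart_add {r : ℕ} (φ ψ : DForm d M r) (x₀ : M) :
    (φ + ψ).inChart x₀ = φ.inChart x₀ + ψ.inChart x₀ := by
  ext y v; simp [DForm.inChart]

lemma DForm.inChart_smul {r : ℕ} (c : ℂ) (φ : DForm d M r) (x₀ : M) :
    (c • φ).inChart x₀ = c • φ.inChart x₀ := by
  ext y v; simp [DForm.inChart]

lemma DForm.IsSmooth.add {r : ℕ} {φ ψ : DForm d M r} (h : φ.IsSmooth) (h' : ψ.IsSmooth) :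
    (φ + ψ).IsSmooth := fun x₀ => by
  rw [DForm.inChart_add]; exact (h x₀).add (h' x₀)

lemma DForm.IsSmooth.smul {r : ℕ} (c : ℂ) {φ : DForm d M r} (h : φ.IsSmooth) :
    (c • φ).IsSmooth := fun x₀ => by
  rw [DForm.inChart_smul]; exact (h x₀).const_smul c

lemma DForm.isSmooth_zero {r : ℕ} : (0 : DForm d M r).IsSmooth := fun x₀ => by
  have : (0 : DForm d M r).inChart x₀ = fun _ => 0 := by ext y v; simp [DForm.inChart]
  rw [this]; exact contDiffOn_const

lemma DForm.IsSmooth.differentiableAt {r : ℕ} {φ : DForm d M r} (h : φ.IsSmooth) (x : M) :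
    DifferentiableAt ℝ (φ.inChart x) (extChartAt 𝓘(ℝ, RModel d) x x) :=
  ((h x).contDiffAt ((isOpen_extChartAt_target x).mem_nhds
    (mem_extChartAt_target x))).differentiableAt (by simp)

lemma DForm.extD_add {r : ℕ} {φ ψ : DForm d M r} (h : φ.IsSmooth) (h' : ψ.IsSmooth) :
    (φ + ψ).extD = φ.extD + ψ.extD := by
  funext x
  simp only [DForm.extD, DForm.add_apply, DForm.inChart_add]
  exact extDeriv_add (h.differentiableAt x) (h'.differentiableAt x)

lemma DForm.extD_smul {r : ℕ} (c : ℂ) {φ : DForm d M r} (h : φ.IsSmooth) :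
    (c • φ).extD = c • φ.extD := by
  funext x
  simp only [DForm.extD, DForm.smul_apply, DForm.inChart_smul]
  ext v
  rw [extDeriv_apply ((h.differentiableAt x).const_smul c),
    ContinuousAlternatingMap.smul_apply, extDeriv_apply (h.differentiableAt x),
    Finset.smul_sum]
  refine Finset.sum_congr rfl fun i _ => ?_
  have h1 : DifferentiableAt ℝ (fun y => φ.inChart x y (i.removeNth v))
      (extChartAt 𝓘(ℝ, RModel d) x x) :=
    (h.differentiableAt x).continuousAlternatingMap_apply_const _
  have h2 : (fun y => (c • φ.inChart x) y (i.removeNth v)) =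
      c • fun y => φ.inChart x y (i.removeNth v) := rfl
  rw [h2, fderiv_const_smul h1, smul_comm]
  rfl

lemma DForm.extD_zero {r : ℕ} : (0 : DForm d M r).extD = 0 := by
  have h := DForm.extD_smul (0 : ℂ) (DForm.isSmooth_zero (d := d) (M := M) (r := r))
  rwa [zero_smul, zero_smul] at h

lemma DForm.wedge_add {r : ℕ} (θ : DForm d M 1) (φ ψ : DForm d M r) :
    θ.wedge (φ + ψ) = θ.wedge φ + θ.wedge ψ := by
  ext x v
  simp [DForm.wedge, ContinuousAlternatingMap.alternatizeUncurryFin_apply,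
    Finset.sum_add_distrib]

lemma DForm.wedge_smul {r : ℕ} (θ : DForm d M 1) (c : ℂ) (φ : DForm d M r) :
    θ.wedge (c • φ) = c • θ.wedge φ := by
  ext x v
  simp [DForm.wedge, ContinuousAlternatingMap.alternatizeUncurryFin_apply, Finset.mul_sum,
    mul_left_comm]

lemma DForm.nabla_add {r : ℕ} (θ : DForm d M 1) {φ ψ : DForm d M r} (h : φ.IsSmooth)
    (h' : ψ.IsSmooth) : DForm.nabla θ (φ + ψ) = DForm.nabla θ φ + DForm.nabla θ ψ := by
  simp only [DForm.nabla, DForm.extD_add h h', DForm.wedge_add]; abel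

lemma DForm.nabla_smul {r : ℕ} (θ : DForm d M 1) (c : ℂ) {φ : DForm d M r} (h : φ.IsSmooth) :
    DForm.nabla θ (c • φ) = c • DForm.nabla θ φ := by
  simp only [DForm.nabla, DForm.extD_smul c h, DForm.wedge_smul, smul_sub]

lemma DForm.nabla_zero {r : ℕ} (θ : DForm d M 1) : DForm.nabla θ (0 : DForm d M r) = 0 := by
  have h := DForm.nabla_smul θ (0 : ℂ) (DForm.isSmooth_zero (d := d) (M := M) (r := r))
  rwa [zero_smul, zero_smul] at h

end Forms

/-! ### Transversally holomorphic foliations -/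

/-- A transversally holomorphic foliation of complex codimension `n` on the `d`-dimensional
manifold `M`, given by a foliated cocycle `(U i, φ i, f i j)` with values in the complex manifold
`N` of dimension `n`: the `U i` are an open cover of `M`, the `φ i : U i → N` are smooth
submersions, and the `f i j : φ i (U i ∩ U j) → φ j (U i ∩ U j)` are holomorphic with
`φ j = f i j ∘ φ i` on `U i ∩ U j`. Then `f i j` and `f j i` are inverse to each other,
so the `f i j` are biholomorphic. -/
structure TransHolFoliation (ι : Type*) (d n : ℕ) (M N : Type*)
    [TopologicalSpace M] [ChartedSpace (RModel d) M]
    [TopologicalSpace N] [ChartedSpace (CModel n) N] where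
  U : ι → Set M
  isOpen_U : ∀ i, IsOpen (U i)
  cover : ∀ x, ∃ i, x ∈ U i
  φ : ι → M → N
  smooth_φ : ∀ i, ContMDiffOn 𝓘(ℝ, RModel d) 𝓘(ℝ, CModel n) ∞ (φ i) (U i)
  submersion_φ : ∀ i, ∀ x ∈ U i,
    Function.Surjective (mfderiv 𝓘(ℝ, RModel d) 𝓘(ℝ, CModel n) (φ i) x)
  f : ι → ι → N → N
  holomorphic_f : ∀ i j,
    MDifferentiableOn 𝓘(ℂ, CModel n) 𝓘(ℂ, CModel n) (f i j) (φ i '' (U i ∩ U j))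
  cocycle : ∀ i j, ∀ x ∈ U i ∩ U j, φ j x = f i j (φ i x)

section Foliation

variable {ι : Type*} {d n : ℕ} {M N : Type*}
  [TopologicalSpace M] [ChartedSpace (RModel d) M]
  [TopologicalSpace N] [ChartedSpace (CModel n) N]

namespace TransHolFoliation

variable (F : TransHolFoliation ι d n M N)

/-- The differential of `φ i` at `x`, which for `x ∈ U i` induces an isomorphism of the normal
space `Q_x = T_x M / T_x F` with the complex vector space `T_{φ i x} N`. The complex structure of
`Q_x` is the one carried over by this isomorphism; it does not depend on `i`, since the `f i j` are
holomorphic. -/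
def dφ (i : ι) (x : M) : RModel d →L[ℝ] CModel n :=
  mfderiv 𝓘(ℝ, RModel d) 𝓘(ℝ, CModel n) (F.φ i) x

/-- The tangent space `T_x F` to the leaf through `x`, that is, the kernel of the differential at
`x` of any of the submersions that are defined at `x`. -/
def tangent (x : M) : Submodule ℝ (RModel d) :=
  ⨅ i, ⨅ _ : x ∈ F.U i, LinearMap.ker (F.dφ i x).toLinearMap

/-- `i_X φ = 0` for all `X` tangent to the foliation. -/
def IsHorizontal {r : ℕ} (φ : DForm d M r) : Prop :=
  ∀ (x : M) (v : Fin r → RModel d) (k : Fin r), v k ∈ F.tangent x → φ x v = 0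

variable {F}

lemma IsHorizontal.add {r : ℕ} {φ ψ : DForm d M r} (h : F.IsHorizontal φ)
    (h' : F.IsHorizontal ψ) : F.IsHorizontal (φ + ψ) := fun x v k hk => by
  simp [h x v k hk, h' x v k hk]

lemma IsHorizontal.smul {r : ℕ} (c : ℂ) {φ : DForm d M r} (h : F.IsHorizontal φ) :
    F.IsHorizontal (c • φ) := fun x v k hk => by
  simp [h x v k hk]

lemma isHorizontal_zero {r : ℕ} : F.IsHorizontal (0 : DForm d M r) := fun x v k _ => by simp

variable (F)

/-- `Ω^r(M/F, E)`, for `E` the trivial complex line bundle with the connection `∇ = d - θ`: the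
smooth `r`-forms `φ` with `i_X φ = 0` and `i_X ∇φ = 0` for all `X` tangent to the foliation. By
Cartan's formula `∇ ∘ i_X + i_X ∘ ∇` the second condition says that the (covariant) Lie derivative
of `φ` along `X` vanishes. For `r = 0` these are the sections `s` with `∇_X s = 0`. -/
def basicE (θ : DForm d M 1) (r : ℕ) : Submodule ℂ (DForm d M r) where
  carrier := {φ | φ.IsSmooth ∧ F.IsHorizontal φ ∧ F.IsHorizontal (DForm.nabla θ φ)}
  add_mem' := fun ⟨a, b, c⟩ ⟨a', b', c'⟩ =>
    ⟨a.add a', b.add b', by rw [DForm.nabla_add θ a a']; exact c.add c'⟩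
  zero_mem' := ⟨DForm.isSmooth_zero, isHorizontal_zero, by
    rw [DForm.nabla_zero]; exact isHorizontal_zero⟩
  smul_mem' := fun z _ ⟨a, b, c⟩ =>
    ⟨a.smul z, b.smul z, by rw [DForm.nabla_smul θ z a]; exact c.smul z⟩

/-- `Ω^r(M/F)`, the basic `r`-forms: the smooth `r`-forms `φ` with `i_X φ = 0` and
`L_X φ = i_X dφ + d i_X φ = i_X dφ = 0` for all `X` tangent to the foliation. -/
def basic (r : ℕ) : Submodule ℂ (DForm d M r) where
  carrier := {φ | φ.IsSmooth ∧ F.IsHorizontal φ ∧ F.IsHorizontal φ.extD}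
  add_mem' := fun ⟨a, b, c⟩ ⟨a', b', c'⟩ =>
    ⟨a.add a', b.add b', by rw [DForm.extD_add a a']; exact c.add c'⟩
  zero_mem' := ⟨DForm.isSmooth_zero, isHorizontal_zero, by
    rw [DForm.extD_zero]; exact isHorizontal_zero⟩
  smul_mem' := fun z _ ⟨a, b, c⟩ =>
    ⟨a.smul z, b.smul z, by rw [DForm.extD_smul z a]; exact c.smul z⟩

/-! ### Types -/

/-- The forms of type `(p, q)`, i.e. with values in `Λ^p (Q^{1,0})^* ⊗ Λ^q (Q^{0,1})^*`. Inside
`Λ^{p+q} Q_ℂ^*` this is the subspace on which the scalars `z ∈ ℂ`, acting on `Q` by its complex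
structure, act as `z^p z̄^q`: if `w k` represents `z` times the class of `v k` in `Q_x` for all `k`,
then `φ (w₁, …, w_r) = z^p z̄^q φ (v₁, …, v_r)`. (The case `z = 1` says that `φ` is a
form on `Q`.) -/
def ofType (p q r : ℕ) : Submodule ℂ (DForm d M r) where
  carrier := {φ | ∀ (x : M) (i : ι), x ∈ F.U i →
    ∀ (z : ℂ) (v w : Fin r → RModel d), (∀ k, F.dφ i x (w k) = z • F.dφ i x (v k)) →
      φ x w = z ^ p * (starRingEnd ℂ z) ^ q * φ x v}
  add_mem' hφ hψ x i hx z v w hvw := by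
    simp [hφ x i hx z v w hvw, hψ x i hx z v w hvw, mul_add]
  zero_mem' x i hx z v w hvw := by simp
  smul_mem' c φ hφ x i hx z v w hvw := by
    simp [hφ x i hx z v w hvw, mul_left_comm]

/-- The space `Ω^{p,q}(M/F, E)` of basic forms of type `(p, q)` with values in `E`. -/
def basicEType (θ : DForm d M 1) (p q r : ℕ) : Submodule ℂ (DForm d M r) :=
  F.basicE θ r ⊓ F.ofType p q r

/-- An index with `x ∈ U i`. -/
def idx (x : M) : ι := (F.cover x).choose

lemma mem_idx (x : M) : x ∈ F.U (F.idx x) := (F.cover x).choose_spec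

lemma exists_lift (x : M) : ∃ J : RModel d →L[ℝ] RModel d, ∀ v,
    F.dφ (F.idx x) x (J v) = Complex.I • F.dφ (F.idx x) x v := by
  obtain ⟨s, hs⟩ := (F.dφ (F.idx x) x).toLinearMap.exists_rightInverse_of_surjective
    (LinearMap.range_eq_top.2 (F.submersion_φ _ x (F.mem_idx x)))
  refine ⟨LinearMap.toContinuousLinearMap
    (s ∘ₗ (Complex.I • (F.dφ (F.idx x) x).toLinearMap)), fun v => ?_⟩
  exact LinearMap.congr_fun hs (Complex.I • F.dφ (F.idx x) x v)

/-- A linear lift to `T_x M` of the complex structure of `Q_x`. On horizontal forms nothing depends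
on its choice. -/
def liftJ (x : M) : RModel d →L[ℝ] RModel d := (F.exists_lift x).choose

/-- A linear lift to `T_x M` of the multiplication by `z` on `Q_x`. -/
def liftMul (x : M) (z : ℂ) : RModel d →L[ℝ] RModel d :=
  z.re • ContinuousLinearMap.id ℝ (RModel d) + z.im • F.liftJ x

lemma dφ_liftMul (x : M) (z : ℂ) (v : RModel d) :
    F.dφ (F.idx x) x (F.liftMul x z v) = z • F.dφ (F.idx x) x v := by
  have h : F.dφ (F.idx x) x (F.liftJ x v) = Complex.I • F.dφ (F.idx x) x v :=
    (F.exists_lift x).choose_spec v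
  ext k
  simp only [liftMul, _root_.add_apply, _root_.smul_apply, map_add,
    map_smul, h, ContinuousLinearMap.id_apply, PiLp.add_apply, PiLp.smul_apply, smul_eq_mul,
    Complex.real_smul]
  conv_rhs => rw [← Complex.re_add_im z]
  ring

/-- The projection of the horizontal `r`-forms, `r = p + q`, onto those of type `(p, q)`. It is
written as the average of `z ↦ z^{-p} z̄^{-q} z^* φ` over the roots of unity `z` of order
`2r + 1`; the two lemmas below say that this is the identity on type `(p, q)` and zero on the other
types `(a, b)` with `a + b = r`. -/
def typeProj (p q : ℕ) {r : ℕ} (φ : DForm d M r) : DForm d M r := fun x =>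
  (1 / (2 * r + 1 : ℂ)) • ∑ k ∈ Finset.range (2 * r + 1),
    let z : ℂ := Complex.exp (2 * Real.pi * Complex.I / (2 * r + 1 : ℕ)) ^ k
    ((z ^ p)⁻¹ * ((starRingEnd ℂ z) ^ q)⁻¹) • (φ x).compContinuousLinearMap (F.liftMul x z)

lemma typeProj_add (p q : ℕ) {r : ℕ} (φ ψ : DForm d M r) :
    F.typeProj p q (φ + ψ) = F.typeProj p q φ + F.typeProj p q ψ := by
  ext x v
  simp [typeProj, ContinuousAlternatingMap.sum_apply, mul_add, Finset.sum_add_distrib]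

lemma typeProj_smul (p q : ℕ) {r : ℕ} (c : ℂ) (φ : DForm d M r) :
    F.typeProj p q (c • φ) = c • F.typeProj p q φ := by
  ext x v
  simp [typeProj, ContinuousAlternatingMap.sum_apply, Finset.mul_sum, mul_left_comm]

lemma typeProj_zero (p q : ℕ) {r : ℕ} : F.typeProj p q (0 : DForm d M r) = 0 := by
  ext x v
  simp [typeProj, ContinuousAlternatingMap.sum_apply]

lemma typeProj_apply_of_mem {a b p q r : ℕ} {φ : DForm d M r} (hφ : φ ∈ F.ofType a b r) (x : M)
    (v : Fin r → RModel d) :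
    F.typeProj p q φ x v = (1 / (2 * r + 1 : ℂ)) * ∑ k ∈ Finset.range (2 * r + 1),
      (let z : ℂ := Complex.exp (2 * Real.pi * Complex.I / (2 * r + 1 : ℕ)) ^ k
      ((z ^ p)⁻¹ * ((starRingEnd ℂ z) ^ q)⁻¹) * (z ^ a * (starRingEnd ℂ z) ^ b)) * φ x v := by
  simp only [typeProj, ContinuousAlternatingMap.smul_apply, ContinuousAlternatingMap.sum_apply,
    smul_eq_mul, ContinuousAlternatingMap.compContinuousLinearMap_apply]
  congr 1
  refine Finset.sum_congr rfl fun k _ => ?_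
  have h := fun z => hφ x (F.idx x) (F.mem_idx x) z v (F.liftMul x z ∘ v)
    (fun j => F.dφ_liftMul x z (v j))
  rw [h]
  ring

lemma typeProj_of_mem {p q r : ℕ} {φ : DForm d M r} (hφ : φ ∈ F.ofType p q r) :
    F.typeProj p q φ = φ := by
  ext x v
  rw [F.typeProj_apply_of_mem hφ]
  have h : (2 * r + 1 : ℂ) ≠ 0 := by exact_mod_cast Nat.succ_ne_zero (2 * r)
  rw [Finset.sum_congr rfl (g := fun _ => φ x v)]
  · simp [h]
  · intro k _
    have h1 : Complex.exp (2 * Real.pi * Complex.I / (2 * r + 1 : ℕ)) ^ k ≠ 0 :=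
      pow_ne_zero _ (Complex.exp_ne_zero _)
    have h2 := (map_ne_zero (starRingEnd ℂ)).2 h1
    simp only
    field_simp

lemma typeProj_of_mem_ne {a b p q r : ℕ} (hab : a + b = r) (hpq : p + q = r) (hne : a ≠ p)
    {φ : DForm d M r} (hφ : φ ∈ F.ofType a b r) : F.typeProj p q φ = 0 := by
  ext x v
  rw [F.typeProj_apply_of_mem hφ, ← Finset.sum_mul]
  set ζ : ℂ := Complex.exp (2 * Real.pi * Complex.I / (2 * r + 1 : ℕ)) with hζ
  have hp : IsPrimitiveRoot ζ (2 * r + 1) := Complex.isPrimitiveRoot_exp _ (by omega)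
  have h0 : ζ ≠ 0 := Complex.exp_ne_zero _
  have hc : starRingEnd ℂ ζ = ζ⁻¹ := by
    rw [Complex.inv_def, Complex.normSq_eq_norm_sq, hp.norm'_eq_one (by omega)]
    simp
  set w : ℂ := ζ ^ ((2 : ℤ) * (a - p)) with hw
  have hterm : ∀ k : ℕ, (((ζ ^ k) ^ p)⁻¹ * ((starRingEnd ℂ (ζ ^ k)) ^ q)⁻¹) *
      ((ζ ^ k) ^ a * (starRingEnd ℂ (ζ ^ k)) ^ b) = w ^ k := by
    intro k
    rw [map_pow, hc, hw]
    simp only [← zpow_natCast, ← zpow_neg, ← zpow_mul, ← zpow_add₀ h0, inv_zpow']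
    congr 1
    have hb : (b : ℤ) = r - a := by omega
    have hq : (q : ℤ) = r - p := by omega
    rw [hb, hq]; ring
  have hw1 : w ≠ 1 := by
    intro h
    obtain ⟨c, hc'⟩ := (hp.zpow_eq_one_iff_dvd _).1 h
    push_cast at hc'
    have hc0 : c ≠ 0 := by
      rintro rfl
      omega
    have : |(2 : ℤ) * (a - p)| ≤ 2 * r := by rw [abs_le]; omega
    rw [hc', abs_mul] at this
    have h1 : 1 ≤ |c| := Int.one_le_abs hc0
    have h2 : |(2 * (r : ℤ) + 1)| = 2 * r + 1 := abs_of_nonneg (by positivity)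
    rw [h2] at this
    nlinarith
  have hwN : w ^ (2 * r + 1) = 1 := by
    rw [hw, ← zpow_natCast, zpow_comm, zpow_natCast, hp.pow_eq_one, one_zpow]
  have hsum : ∑ k ∈ Finset.range (2 * r + 1), w ^ k = 0 := by
    have := mul_geom_sum w (2 * r + 1)
    rw [hwN, sub_self] at this
    exact (mul_eq_zero.1 this).resolve_left (sub_ne_zero.2 hw1)
  simp only [hterm, hsum]
  simp

/-! ### The operators `∂_E`, `∂̄_E` and the cohomologies -/

/-- `∂_E : Ω^{p,q}(M/F, E) → Ω^{p+1,q}(M/F, E)`, the part of type `(p + 1, q)` of `∇`. -/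
def del (θ : DForm d M 1) (p q : ℕ) {r : ℕ} (φ : DForm d M r) : DForm d M (r + 1) :=
  F.typeProj (p + 1) q (DForm.nabla θ φ)

/-- `∂̄_E : Ω^{p,q}(M/F, E) → Ω^{p,q+1}(M/F, E)`, the part of type `(p, q + 1)` of `∇`. -/
def delbar (θ : DForm d M 1) (p q : ℕ) {r : ℕ} (φ : DForm d M r) : DForm d M (r + 1) :=
  F.typeProj p (q + 1) (DForm.nabla θ φ)

variable {F}

lemma del_add {θ : DForm d M 1} (p q : ℕ) {r : ℕ} {φ ψ : DForm d M r} (h : φ.IsSmooth)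
    (h' : ψ.IsSmooth) : F.del θ p q (φ + ψ) = F.del θ p q φ + F.del θ p q ψ := by
  rw [del, DForm.nabla_add θ h h', typeProj_add]; rfl

lemma del_smul {θ : DForm d M 1} (p q : ℕ) {r : ℕ} (c : ℂ) {φ : DForm d M r} (h : φ.IsSmooth) :
    F.del θ p q (c • φ) = c • F.del θ p q φ := by
  rw [del, DForm.nabla_smul θ c h, typeProj_smul]; rfl

lemma del_zero {θ : DForm d M 1} (p q : ℕ) {r : ℕ} : F.del θ p q (0 : DForm d M r) = 0 := by
  rw [del, DForm.nabla_zero, typeProj_zero]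

lemma delbar_add {θ : DForm d M 1} (p q : ℕ) {r : ℕ} {φ ψ : DForm d M r} (h : φ.IsSmooth)
    (h' : ψ.IsSmooth) : F.delbar θ p q (φ + ψ) = F.delbar θ p q φ + F.delbar θ p q ψ := by
  rw [delbar, DForm.nabla_add θ h h', typeProj_add]; rfl

lemma delbar_smul {θ : DForm d M 1} (p q : ℕ) {r : ℕ} (c : ℂ) {φ : DForm d M r}
    (h : φ.IsSmooth) : F.delbar θ p q (c • φ) = c • F.delbar θ p q φ := by
  rw [delbar, DForm.nabla_smul θ c h, typeProj_smul]; rfl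

lemma delbar_zero {θ : DForm d M 1} (p q : ℕ) {r : ℕ} :
    F.delbar θ p q (0 : DForm d M r) = 0 := by
  rw [delbar, DForm.nabla_zero, typeProj_zero]

variable (F)

/-- The `d_θ`-closed basic `r`-forms, `d_θ = d - θ ∧`. -/
def lichCocycles (θ : DForm d M 1) (r : ℕ) : Submodule ℂ (DForm d M r) where
  carrier := {φ | φ ∈ F.basic r ∧ DForm.nabla θ φ = 0}
  add_mem' := fun ⟨a, b⟩ ⟨a', b'⟩ =>
    ⟨add_mem a a', by rw [DForm.nabla_add θ a.1 a'.1, b, b', add_zero]⟩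
  zero_mem' := ⟨zero_mem _, DForm.nabla_zero θ⟩
  smul_mem' := fun c _ ⟨a, b⟩ =>
    ⟨Submodule.smul_mem _ c a, by rw [DForm.nabla_smul θ c a.1, b]; exact smul_zero c⟩

/-- The image `d_θ Ω^{r-1}(M/F)` (zero for `r = 0`). -/
def lichCoboundaries (θ : DForm d M 1) : (r : ℕ) → Submodule ℂ (DForm d M r)
  | 0 => ⊥
  | r + 1 =>
    { carrier := {φ | ∃ ψ ∈ F.basic r, DForm.nabla θ ψ = φ}
      add_mem' := by
        rintro _ _ ⟨ψ, h, rfl⟩ ⟨ψ', h', rfl⟩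
        exact ⟨ψ + ψ', add_mem h h', DForm.nabla_add θ h.1 h'.1⟩
      zero_mem' := ⟨0, zero_mem _, DForm.nabla_zero θ⟩
      smul_mem' := by
        rintro c _ ⟨ψ, h, rfl⟩
        exact ⟨c • ψ, Submodule.smul_mem _ c h, DForm.nabla_smul θ c h.1⟩ }

/-- The basic Lichnerowicz cohomology `H^r_θ(M/F)`. -/
abbrev LichCohomology (θ : DForm d M 1) (r : ℕ) :=
  F.lichCocycles θ r ⧸ (F.lichCoboundaries θ r).submoduleOf (F.lichCocycles θ r)

/-- The kernel of `∂̄_E` on `Ω^{0,q}(M/F, E)`. -/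
def holCocycles (θ : DForm d M 1) (q : ℕ) : Submodule ℂ (DForm d M q) where
  carrier := {φ | φ ∈ F.basicEType θ 0 q q ∧ F.delbar θ 0 q φ = 0}
  add_mem' := fun ⟨a, b⟩ ⟨a', b'⟩ =>
    ⟨add_mem a a', by rw [delbar_add 0 q a.1.1 a'.1.1, b, b', add_zero]⟩
  zero_mem' := ⟨zero_mem _, delbar_zero 0 q⟩
  smul_mem' := fun c _ ⟨a, b⟩ =>
    ⟨Submodule.smul_mem _ c a, by rw [delbar_smul 0 q c a.1.1, b]; exact smul_zero c⟩

/-- The image `∂̄_E Ω^{0,q-1}(M/F, E)` (zero for `q = 0`). -/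
def holCoboundaries (θ : DForm d M 1) : (q : ℕ) → Submodule ℂ (DForm d M q)
  | 0 => ⊥
  | q + 1 =>
    { carrier := {φ | ∃ ψ ∈ F.basicEType θ 0 q q, F.delbar θ 0 q ψ = φ}
      add_mem' := by
        rintro _ _ ⟨ψ, h, rfl⟩ ⟨ψ', h', rfl⟩
        exact ⟨ψ + ψ', add_mem h h', delbar_add 0 q h.1.1 h'.1.1⟩
      zero_mem' := ⟨0, zero_mem _, delbar_zero 0 q⟩
      smul_mem' := by
        rintro c _ ⟨ψ, h, rfl⟩
        exact ⟨c • ψ, Submodule.smul_mem _ c h, delbar_smul 0 q c h.1.1⟩ }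

/-- The holomorphic basic cohomology `H^q(M/F, 𝓔)`, the cohomology of the complex
`(Ω^{0,•}(M/F, E), ∂̄_E)`. -/
abbrev HolCohomology (θ : DForm d M 1) (q : ℕ) :=
  F.holCocycles θ q ⧸ (F.holCoboundaries θ q).submoduleOf (F.holCocycles θ q)

/-- The kernel of `∂_E` on `Ω^{p,0}(M/F, E)`. -/
def antiholCocycles (θ : DForm d M 1) (p : ℕ) : Submodule ℂ (DForm d M p) where
  carrier := {φ | φ ∈ F.basicEType θ p 0 p ∧ F.del θ p 0 φ = 0}
  add_mem' := fun ⟨a, b⟩ ⟨a', b'⟩ =>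
    ⟨add_mem a a', by rw [del_add p 0 a.1.1 a'.1.1, b, b', add_zero]⟩
  zero_mem' := ⟨zero_mem _, del_zero p 0⟩
  smul_mem' := fun c _ ⟨a, b⟩ =>
    ⟨Submodule.smul_mem _ c a, by rw [del_smul p 0 c a.1.1, b]; exact smul_zero c⟩

/-- The image `∂_E Ω^{p-1,0}(M/F, E)` (zero for `p = 0`). -/
def antiholCoboundaries (θ : DForm d M 1) : (p : ℕ) → Submodule ℂ (DForm d M p)
  | 0 => ⊥
  | p + 1 =>
    { carrier := {φ | ∃ ψ ∈ F.basicEType θ p 0 p, F.del θ p 0 ψ = φ}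
      add_mem' := by
        rintro _ _ ⟨ψ, h, rfl⟩ ⟨ψ', h', rfl⟩
        exact ⟨ψ + ψ', add_mem h h', del_add p 0 h.1.1 h'.1.1⟩
      zero_mem' := ⟨0, zero_mem _, del_zero p 0⟩
      smul_mem' := by
        rintro c _ ⟨ψ, h, rfl⟩
        exact ⟨c • ψ, Submodule.smul_mem _ c h, del_smul p 0 c h.1.1⟩ }

/-- The cohomology of the complex `(Ω^{•,0}(M/F, E), ∂_E)`. -/
abbrev AntiholCohomology (θ : DForm d M 1) (p : ℕ) :=
  F.antiholCocycles θ p ⧸ (F.antiholCoboundaries θ p).submoduleOf (F.antiholCocycles θ p)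

/-- The intersection of the kernels of `∂_E` and `∂̄_E` on `Ω^{p,q}(M/F, E)`, `r = p + q`. -/
def bcCocycles (θ : DForm d M 1) (p q r : ℕ) : Submodule ℂ (DForm d M r) where
  carrier := {φ | φ ∈ F.basicEType θ p q r ∧ F.del θ p q φ = 0 ∧ F.delbar θ p q φ = 0}
  add_mem' := fun ⟨a, b, c⟩ ⟨a', b', c'⟩ =>
    ⟨add_mem a a', by rw [del_add p q a.1.1 a'.1.1, b, b', add_zero],
      by rw [delbar_add p q a.1.1 a'.1.1, c, c', add_zero]⟩
  zero_mem' := ⟨zero_mem _, del_zero p q, delbar_zero p q⟩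
  smul_mem' := fun z _ ⟨a, b, c⟩ =>
    ⟨Submodule.smul_mem _ z a, by rw [del_smul p q z a.1.1, b]; exact smul_zero z,
      by rw [delbar_smul p q z a.1.1, c]; exact smul_zero z⟩

/-- The image `∂_E ∂̄_E Ω^{p-1,q-1}(M/F, E)`, `r = p + q` (zero for `p = 0` or `q = 0`); the
intermediate `∂̄_E ψ` is taken in `Ω^{p-1,q}(M/F, E)`. -/
def bcCoboundaries (θ : DForm d M 1) : (p q r : ℕ) → Submodule ℂ (DForm d M r)
  | p + 1, q + 1, r + 2 =>
    { carrier := {φ | ∃ ψ ∈ F.basicEType θ p q r, ∃ χ ∈ F.basicEType θ p (q + 1) (r + 1),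
        χ = F.delbar θ p q ψ ∧ F.del θ p (q + 1) χ = φ}
      add_mem' := by
        rintro _ _ ⟨ψ, h, χ, k, e, rfl⟩ ⟨ψ', h', χ', k', e', rfl⟩
        exact ⟨ψ + ψ', add_mem h h', χ + χ', add_mem k k',
          by rw [e, e', delbar_add p q h.1.1 h'.1.1], del_add p (q + 1) k.1.1 k'.1.1⟩
      zero_mem' := ⟨0, zero_mem _, 0, zero_mem _, (delbar_zero p q).symm, del_zero p (q + 1)⟩
      smul_mem' := by
        rintro c _ ⟨ψ, h, χ, k, e, rfl⟩
        exact ⟨c • ψ, Submodule.smul_mem _ c h, c • χ, Submodule.smul_mem _ c k,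
          by rw [e, delbar_smul p q c h.1.1], del_smul p (q + 1) c k.1.1⟩ }
  | _, _, _ => ⊥

/-- The basic Bott-Chern cohomology `H^{p,q}_BC(M/F, E)`, `r = p + q`. -/
abbrev BCCohomology (θ : DForm d M 1) (p q r : ℕ) :=
  F.bcCocycles θ p q r ⧸ (F.bcCoboundaries θ p q r).submoduleOf (F.bcCocycles θ p q r)

end TransHolFoliation
end Foliation

/-! ### Subquotients and conjugate vector spaces -/

/-- The class in `Z / (B ∩ Z)` of an element of `Z`. -/
def cohClass {V : Type*} [AddCommGroup V] [Module ℂ V] {Z B : Submodule ℂ V} (x : V)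
    (hx : x ∈ Z) : Z ⧸ B.submoduleOf Z :=
  Submodule.Quotient.mk ⟨x, hx⟩

/-- The complex conjugate of a complex vector space: the same additive group, on which `z` acts as
`z̄` does on `V`. -/
def ConjSpace (V : Type*) := V

instance {V : Type*} [AddCommGroup V] : AddCommGroup (ConjSpace V) :=
  inferInstanceAs (AddCommGroup V)

instance {V : Type*} [AddCommGroup V] [Module ℂ V] : Module ℂ (ConjSpace V) :=
  Module.compHom V (starRingEnd ℂ)

/-- The element of the conjugate space given by an element of `V`. -/
def ConjSpace.of {V : Type*} (x : V) : ConjSpace V := x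

end

/-!
The operator `∇ = d - θ ∧` satisfies `∇² = 0`, because `θ` is closed. Two facts about the
transverse complex structure turn the exactness into a computation with types.

First, `∇` maps a basic form of type `(p, q)` to the sum of forms of types `(p + 1, q)` and
`(p, q + 1)`, so that `∇ = ∂ + ∂̄` (`exists_nabla_eq_add`, `nabla_eq_del_add_delbar`). In a chart the
foliation is given by a submersion `g` to `ℂⁿ`, and every tangent vector `v` at a point `x`
extends to a smooth vector field `y ↦ V y v` which is parallel, in the sense that `dg (V y v)` is
constant in `y` (`exists_parallel_frame`). The brackets of such fields are tangent to the fibres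
of `g`, so on horizontal forms `d` is computed by parallel fields without bracket terms
(`extDeriv_apply_parallel`). Parallel fields preserve the relation "`w` represents `z` times the
class of `v`", so `∇φ` transforms under multiplication of its arguments by `z` as `z^p z̄^q` times
the value at `z` of a real linear function of `z`, and such a function is a combination of `z` and
`z̄`.

Second, a basic `1`-form `ψ` is the sum of basic forms of types `(1, 0)` and `(0, 1)`
(`exists_basic_eq_add`): with `J` the complex structure of the normal bundle, `ψ ∘ J` is again
smooth, since `J` has smooth local lifts to the tangent bundle, and again basic, by the
computation with parallel fields.

On cocycles `α` of type `(0, 1)` and `β` of type `(1, 0)` one has `∂α = ∇α` and `∂̄β = ∇β`, so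
these forms are closed under `∇`, hence under `∂` and `∂̄`, and they vanish in Lichnerowicz
cohomology. Conversely, if `η = ∇ψ` is of type `(1, 1)` and `ψ = β + α` is the decomposition into
types, then the components of types `(2, 0)` and `(0, 2)` give `∂β = 0` and `∂̄α = 0`, and
`η = ∂α + ∂̄β` (`exists_eq_del_add_delbar`). Conjugation exchanges `∂` and `∂̄`, since `θ` is real, which
gives the isomorphism `conjEquiv`.
-/

noncomputable section

open ContinuousAlternatingMap Filter Topology

set_option linter.unusedSectionVars false

/-! ### Calculus of differential forms on a normed space -/

section Calculus

variable {E G : Type*} [NormedAddCommGroup E] [NormedSpace ℝ E]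
  [NormedAddCommGroup G] [NormedSpace ℝ G]

/-- The exterior product of a `1`-form with the alternatization of `T` is the double alternatization
of `k, l ↦ a k • T l`. -/
lemma smulRight_alternatizeUncurryFin {r : ℕ} (a : E →L[ℝ] ℂ) (T : E →L[ℝ] E [⋀^Fin r]→L[ℝ] ℂ) :
    a.smulRight (alternatizeUncurryFin T) = alternatizeUncurryFinCLM ℝ E ℂ ∘L
      ((ContinuousLinearMap.compL ℝ E (E [⋀^Fin r]→L[ℝ] ℂ) (E [⋀^Fin r]→L[ℝ] ℂ)).flip T ∘L
        (ContinuousLinearMap.lsmul ℝ ℂ ∘L a)) := by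
  ext k v
  simp [alternatizeUncurryFin_apply, Finset.mul_sum, mul_left_comm]

/-- `θ ∧ (θ ∧ η) = 0`. -/
lemma alternatizeUncurryFin_smulRight_self {r : ℕ} (a : E →L[ℝ] ℂ) (η : E [⋀^Fin r]→L[ℝ] ℂ) :
    alternatizeUncurryFin (a.smulRight (alternatizeUncurryFin (a.smulRight η))) = 0 := by
  rw [smulRight_alternatizeUncurryFin]
  refine alternatizeUncurryFin_alternatizeUncurryFinCLM_comp_of_symmetric fun k l => ?_
  simp [smul_smul, mul_comm]

lemma hasFDerivAt_smulRight {A : Type*} [NormedAddCommGroup A] [NormedSpace ℝ A] [NormedSpace ℂ A]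
    [IsScalarTower ℝ ℂ A] {a : E → E →L[ℝ] ℂ} {η : E → A} {x : E}
    (ha : DifferentiableAt ℝ a x) (hη : DifferentiableAt ℝ η x) :
    ∃ D : E →L[ℝ] E →L[ℝ] A, HasFDerivAt (fun y => (a y).smulRight (η y)) D x ∧
      ∀ k l, D k l = a x l • fderiv ℝ η x k + fderiv ℝ a x k l • η x := by
  -- The product as a bilinear map, with the factor from `A` first.
  set B := (ContinuousLinearMap.lsmul ℝ ℂ : ℂ →L[ℝ] A →L[ℝ] A).flip
  have h1 : HasFDerivAt (fun y => B (η y)) (B ∘L fderiv ℝ η x) x :=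
    HasFDerivAt.comp (g := B) x B.hasFDerivAt hη.hasFDerivAt
  exact ⟨_, h1.clm_comp ha.hasFDerivAt, fun k l => by simp [B, add_comm]⟩

/-- The product rule `d(θ ∧ η) = - θ ∧ dη` for a closed `1`-form `θ`. -/
lemma extDeriv_wedge_of_symmetric {r : ℕ} {a : E → E →L[ℝ] ℂ} {η : E → E [⋀^Fin r]→L[ℝ] ℂ} {x : E}
    (ha : DifferentiableAt ℝ a x) (hη : DifferentiableAt ℝ η x)
    (hs : ∀ k l, fderiv ℝ a x k l = fderiv ℝ a x l k) :
    extDeriv (fun y => alternatizeUncurryFin ((a y).smulRight (η y))) x =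
      -alternatizeUncurryFin ((a x).smulRight (extDeriv η x)) := by
  obtain ⟨D, hD, hD'⟩ := hasFDerivAt_smulRight ha hη
  have hA := (alternatizeUncurryFinCLM ℝ E ℂ (n := r)).hasFDerivAt.comp x hD
  rw [extDeriv, show fderiv ℝ (fun y => alternatizeUncurryFin ((a y).smulRight (η y))) x = _ from
    hA.fderiv, eq_neg_iff_add_eq_zero, extDeriv, smulRight_alternatizeUncurryFin,
    ← alternatizeUncurryFin_add, ← ContinuousLinearMap.comp_add]
  refine alternatizeUncurryFin_alternatizeUncurryFinCLM_comp_of_symmetric fun k l => ?_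
  simp [hD', hs k l]
  abel

lemma contDiffAt_extDeriv {r : ℕ} {η : E → E [⋀^Fin r]→L[ℝ] ℂ} {x : E}
    (hη : ContDiffAt ℝ ∞ η x) : ContDiffAt ℝ ∞ (extDeriv η) x := by
  have h := hη.fderiv_right (m := ∞) (by simp)
  exact (alternatizeUncurryFinCLM ℝ E ℂ (n := r)).contDiff.contDiffAt.comp x h

lemma contDiffAt_smulRight {A : Type*} [NormedAddCommGroup A] [NormedSpace ℝ A] [NormedSpace ℂ A]
    [IsScalarTower ℝ ℂ A] {a : E → E →L[ℝ] ℂ} {η : E → A} {x : E}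
    (ha : ContDiffAt ℝ ∞ a x) (hη : ContDiffAt ℝ ∞ η x) :
    ContDiffAt ℝ ∞ (fun y => (a y).smulRight (η y)) x :=
  (ContDiffAt.comp x (g := (ContinuousLinearMap.lsmul ℝ ℂ : ℂ →L[ℝ] A →L[ℝ] A).flip)
    (ContinuousLinearMap.contDiff _).contDiffAt hη).clm_comp ha

lemma contDiffAt_wedge {r : ℕ} {a : E → E →L[ℝ] ℂ} {η : E → E [⋀^Fin r]→L[ℝ] ℂ} {x : E}
    (ha : ContDiffAt ℝ ∞ a x) (hη : ContDiffAt ℝ ∞ η x) :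
    ContDiffAt ℝ ∞ (fun y => alternatizeUncurryFin ((a y).smulRight (η y))) x := by
  have h := contDiffAt_smulRight ha hη
  exact (alternatizeUncurryFinCLM ℝ E ℂ (n := r)).contDiff.contDiffAt.comp x h

lemma minSmoothness_le_infty : minSmoothness ℝ 2 ≤ (∞ : WithTop ℕ∞) := by
  rw [minSmoothness_of_isRCLikeNormedField]
  exact WithTop.coe_le_coe.2 le_top

/-- A submersion germ admits parallel vector fields: every vector at `x` extends, linearly, to a
smooth vector field near `x` whose image under the derivative of `g` is constant. -/
lemma exists_parallel_frame [CompleteSpace E] [FiniteDimensional ℝ G] {g : E → G} {x : E}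
    (hg : ContDiffAt ℝ ∞ g x) (hs : Function.Surjective (fderiv ℝ g x)) :
    ∃ V : E → E →L[ℝ] E, ContDiffAt ℝ ∞ V x ∧ V x = ContinuousLinearMap.id ℝ E ∧
      ∀ᶠ y in 𝓝 x, (fderiv ℝ g y).comp (V y) = fderiv ℝ g x := by
  obtain ⟨s, hs⟩ := (fderiv ℝ g x).toLinearMap.exists_rightInverse_of_surjective
    (LinearMap.range_eq_top.2 hs)
  have : CompleteSpace G := FiniteDimensional.complete ℝ G
  set S : G →L[ℝ] E := LinearMap.toContinuousLinearMap s
  have hS : (fderiv ℝ g x).comp S = ContinuousLinearMap.id ℝ G := by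
    ext c; exact LinearMap.congr_fun hs c
  have hdg : ContDiffAt ℝ ∞ (fderiv ℝ g) x := hg.fderiv_right (by simp)
  have hT : ContDiffAt ℝ ∞ (fun y => (fderiv ℝ g y).comp S) x := hdg.clm_comp contDiffAt_const
  have hTx : ((fderiv ℝ g x).comp S).IsInvertible := by
    rw [hS]; exact ContinuousLinearMap.isInvertible_equiv (f := ContinuousLinearEquiv.refl ℝ G)
  have hinv : ContDiffAt ℝ ∞ (fun y => ((fderiv ℝ g y).comp S).inverse) x :=
    ContDiffAt.comp x (g := ContinuousLinearMap.inverse)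
      (hTx.contDiffAt_map_inverse (n := ∞)) hT
  -- `V y = 1 - S (Dg_y S)⁻¹ (Dg_y - Dg_x)`, where `S` is a right inverse of `Dg_x`.
  refine ⟨fun y => ContinuousLinearMap.id ℝ E - (S.comp ((fderiv ℝ g y).comp S).inverse).comp
    (fderiv ℝ g y - fderiv ℝ g x), ?_, by simp, ?_⟩
  · exact contDiffAt_const.sub ((contDiffAt_const.clm_comp hinv).clm_comp
      (hdg.sub contDiffAt_const))
  · have hev : ∀ᶠ y in 𝓝 x, ((fderiv ℝ g y).comp S).IsInvertible := by
      obtain ⟨e, he⟩ := hTx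
      have := hT.continuousAt.eventually (f := fun y => (fderiv ℝ g y).comp S)
        (p := fun T => T ∈ Set.range ((↑) : (G ≃L[ℝ] G) → G →L[ℝ] G))
        (by simp only [← he]; exact ContinuousLinearEquiv.nhds e)
      exact this.mono fun y ⟨e, he⟩ => ⟨e, he⟩
    filter_upwards [hev] with y hy
    ext v
    have h2 := fun c => DFunLike.congr_fun hy.self_comp_inverse c
    simp only [ContinuousLinearMap.comp_apply, ContinuousLinearMap.id_apply] at h2
    simp [h2]

/-- The bracket of two parallel vector fields is tangent to the fibres. -/
lemma fderiv_lieBracket_parallel {g : E → G} {x : E} (hg : ContDiffAt ℝ ∞ g x)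
    {V : E → E →L[ℝ] E} (hV : ContDiffAt ℝ ∞ V x)
    (hpar : ∀ᶠ y in 𝓝 x, (fderiv ℝ g y).comp (V y) = fderiv ℝ g x) (hx : V x = .id ℝ E) (u v : E) :
    fderiv ℝ g x (VectorField.lieBracket ℝ (fun y => V y u) (fun y => V y v) x) = 0 := by
  have hd : DifferentiableAt ℝ (fderiv ℝ g) x :=
    (hg.fderiv_right (m := ∞) (by simp)).differentiableAt (by simp)
  have hVd : DifferentiableAt ℝ V x := hV.differentiableAt (by simp)
  have hVw : ∀ w, DifferentiableAt ℝ (fun y => V y w) x := fun w =>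
    hVd.clm_apply (differentiableAt_const _)
  -- Differentiating `dg (V y w) = const` at `x`.
  have key : ∀ w k, fderiv ℝ g x (fderiv ℝ (fun y => V y w) x k) =
      -fderiv ℝ (fderiv ℝ g) x k w := by
    intro w k
    have h1 : (fun y => fderiv ℝ g y (V y w)) =ᶠ[𝓝 x] fun _ => fderiv ℝ g x w := by
      filter_upwards [hpar] with y hy
      exact DFunLike.congr_fun hy w
    have h2 := (hd.hasFDerivAt.clm_apply (hVw w).hasFDerivAt).fderiv
    rw [h1.fderiv_eq] at h2
    have h3 := DFunLike.congr_fun h2 k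
    simp [hx] at h3
    exact eq_neg_of_add_eq_zero_left h3.symm
  have hsym : IsSymmSndFDerivAt ℝ g x :=
    hg.isSymmSndFDerivAt minSmoothness_le_infty
  simp only [VectorField.lieBracket, map_sub, key, hx, ContinuousLinearMap.id_apply]
  rw [hsym.eq v u]; simp

/-- For a form that vanishes on the tangent vectors of the fibres of `g`, the exterior derivative
is computed by parallel vector fields without bracket terms. -/
lemma extDeriv_apply_parallel {g : E → G} {x : E} (hg : ContDiffAt ℝ ∞ g x)
    {V : E → E →L[ℝ] E} (hV : ContDiffAt ℝ ∞ V x)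
    (hpar : ∀ᶠ y in 𝓝 x, (fderiv ℝ g y).comp (V y) = fderiv ℝ g x) (hx : V x = .id ℝ E)
    {r : ℕ} {η : E → E [⋀^Fin r]→L[ℝ] ℂ} (hη : DifferentiableAt ℝ η x)
    (hhor : ∀ (v : Fin r → E) k, fderiv ℝ g x (v k) = 0 → η x v = 0) (v : Fin (r + 1) → E) :
    extDeriv η x v = ∑ i : Fin (r + 1), (-1) ^ (i : ℕ) •
      fderiv ℝ (fun y => η y (fun k => V y (i.removeNth v k))) x (v i) := by
  cases r with
  | zero =>
    rw [extDeriv_apply hη]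
    refine Finset.sum_congr rfl fun i _ => ?_
    congr 2
    refine congrArg (fun f => fderiv ℝ f x) ?_
    funext y
    exact congrArg _ (Subsingleton.elim _ _)
  | succ m =>
    have hVd : DifferentiableAt ℝ V x := hV.differentiableAt (by simp)
    have h := extDeriv_apply_vectorField (V := fun i y => V y (v i)) hη
      (fun i => hVd.clm_apply (differentiableAt_const _))
    simp only [hx, ContinuousLinearMap.id_apply] at h
    rw [h, sub_eq_self.2]
    · rfl
    · refine Finset.sum_eq_zero fun i _ => Finset.sum_eq_zero fun j _ => ?_
      rw [hhor _ 0, smul_zero]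
      exact fderiv_lieBracket_parallel hg hV hpar hx _ _

/-- The linear functional underlying an alternating `1`-form. -/
def oneFormCLM (E : Type*) [NormedAddCommGroup E] [NormedSpace ℝ E] :
    (E [⋀^Fin 1]→L[ℝ] ℂ) →L[ℝ] E →L[ℝ] ℂ :=
  ((ofSubsingletonLIE (𝕜 := ℝ) (E := E) (F := ℂ) (0 : Fin 1)).symm :
    (E [⋀^Fin 1]→L[ℝ] ℂ) →L[ℝ] E →L[ℝ] ℂ)

lemma oneFormCLM_apply (η : E [⋀^Fin 1]→L[ℝ] ℂ) (v : E) : oneFormCLM E η v = η fun _ => v := rfl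

lemma ofSubsingleton_symm_eq_oneFormCLM (η : E [⋀^Fin 1]→L[ℝ] ℂ) :
    (ofSubsingleton ℝ E ℂ (0 : Fin 1)).symm η = oneFormCLM E η := rfl

/-- The derivative of a closed `1`-form is symmetric. -/
lemma fderiv_oneFormCLM_symm {η : E → E [⋀^Fin 1]→L[ℝ] ℂ} {x : E} (hη : DifferentiableAt ℝ η x)
    (hc : extDeriv η x = 0) (k l : E) :
    fderiv ℝ (fun y => oneFormCLM E (η y)) x k l =
      fderiv ℝ (fun y => oneFormCLM E (η y)) x l k := by
  have h1 : HasFDerivAt (fun y => oneFormCLM E (η y)) ((oneFormCLM E).comp (fderiv ℝ η x)) x :=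
    HasFDerivAt.comp (g := oneFormCLM E) x (oneFormCLM E).hasFDerivAt hη.hasFDerivAt
  rw [h1.fderiv]
  have h2 := DFunLike.congr_fun hc ![k, l]
  simp only [ContinuousLinearMap.comp_apply, oneFormCLM_apply]
  have e1 : Fin.removeNth (0 : Fin 2) ![k, l] = fun _ => l := by
    funext i; fin_cases i; rfl
  have e2 : Fin.removeNth (1 : Fin 2) ![k, l] = fun _ => k := by
    funext i; fin_cases i; rfl
  rw [extDeriv, alternatizeUncurryFin_apply, Fin.sum_univ_two, e1, e2] at h2
  simp at h2
  exact add_neg_eq_zero.1 h2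

end Calculus

/-! ### Forms in charts, and flatness of the connection -/

section Charts

variable {d : ℕ} {M : Type*} [TopologicalSpace M] [ChartedSpace (RModel d) M]

lemma extChartAt_target_mem_nhds_of_mem {x₀ : M} {y : RModel d}
    (hy : y ∈ (extChartAt 𝓘(ℝ, RModel d) x₀).target) :
    (extChartAt 𝓘(ℝ, RModel d) x₀).target ∈ 𝓝 y :=
  (isOpen_extChartAt_target x₀).mem_nhds hy

lemma DForm.IsSmooth.contDiffAt {r : ℕ} {φ : DForm d M r} (h : φ.IsSmooth) {x₀ : M}
    {y : RModel d} (hy : y ∈ (extChartAt 𝓘(ℝ, RModel d) x₀).target) :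
    ContDiffAt ℝ ∞ (φ.inChart x₀) y :=
  (h x₀).contDiffAt (extChartAt_target_mem_nhds_of_mem hy)

lemma DForm.isSmooth_of_contDiffAt {r : ℕ} {φ : DForm d M r}
    (h : ∀ (x₀ : M), ∀ y ∈ (extChartAt 𝓘(ℝ, RModel d) x₀).target,
      ContDiffAt ℝ ∞ (φ.inChart x₀) y) : φ.IsSmooth :=
  fun x₀ y hy => (h x₀ y hy).contDiffWithinAt

lemma DForm.wedge_apply {r : ℕ} (θ : DForm d M 1) (φ : DForm d M r) (x : M)
    (v : Fin (r + 1) → RModel d) : θ.wedge φ x v = ∑ i : Fin (r + 1),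
      (-1) ^ (i : ℕ) • (oneFormCLM (RModel d) (θ x) (v i) * φ x (i.removeNth v)) := by
  simp [DForm.wedge, alternatizeUncurryFin_apply, ofSubsingleton_symm_eq_oneFormCLM]

lemma DForm.inChart_wedge {r : ℕ} (θ : DForm d M 1) (φ : DForm d M r) (x₀ : M) (y : RModel d) :
    (θ.wedge φ).inChart x₀ y = alternatizeUncurryFin
      ((oneFormCLM (RModel d) (θ.inChart x₀ y)).smulRight (φ.inChart x₀ y)) := by
  ext v
  simp only [DForm.inChart, compContinuousLinearMap_apply, DForm.wedge_apply,
    alternatizeUncurryFin_apply]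
  rfl

lemma DForm.wedge_wedge {r : ℕ} (θ : DForm d M 1) (φ : DForm d M r) :
    θ.wedge (θ.wedge φ) = 0 :=
  funext fun _ => alternatizeUncurryFin_smulRight_self _ _

lemma DForm.wedge_sub {r : ℕ} (θ : DForm d M 1) (φ ψ : DForm d M r) :
    θ.wedge (φ - ψ) = θ.wedge φ - θ.wedge ψ := by
  rw [eq_sub_iff_add_eq, ← DForm.wedge_add, sub_add_cancel]

lemma DForm.contDiffAt_oneFormCLM_inChart {θ : DForm d M 1} (hθ : θ.IsSmooth) {x₀ : M}
    {y : RModel d} (hy : y ∈ (extChartAt 𝓘(ℝ, RModel d) x₀).target) :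
    ContDiffAt ℝ ∞ (fun y => oneFormCLM (RModel d) (θ.inChart x₀ y)) y := by
  have h := hθ.contDiffAt hy
  exact (oneFormCLM (RModel d)).contDiff.contDiffAt.comp y h

lemma DForm.IsSmooth.wedge {r : ℕ} {θ : DForm d M 1} {φ : DForm d M r} (hθ : θ.IsSmooth)
    (hφ : φ.IsSmooth) : (θ.wedge φ).IsSmooth := by
  refine DForm.isSmooth_of_contDiffAt fun x₀ y hy => ?_
  rw [funext (DForm.inChart_wedge θ φ x₀)]
  exact contDiffAt_wedge (DForm.contDiffAt_oneFormCLM_inChart hθ hy) (hφ.contDiffAt hy)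

lemma DForm.IsSmooth.neg {r : ℕ} {φ : DForm d M r} (h : φ.IsSmooth) : (-φ).IsSmooth := by
  rw [← neg_one_smul ℂ φ]; exact h.smul (-1)

lemma DForm.IsSmooth.sub {r : ℕ} {φ ψ : DForm d M r} (h : φ.IsSmooth) (h' : ψ.IsSmooth) :
    (φ - ψ).IsSmooth := by
  rw [sub_eq_add_neg]; exact h.add h'.neg

lemma DForm.extD_sub {r : ℕ} {φ ψ : DForm d M r} (h : φ.IsSmooth) (h' : ψ.IsSmooth) :
    (φ - ψ).extD = φ.extD - ψ.extD := by
  rw [eq_sub_iff_add_eq, ← DForm.extD_add (h.sub h') h', sub_add_cancel]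

lemma DForm.nabla_sub {r : ℕ} (θ : DForm d M 1) {φ ψ : DForm d M r} (h : φ.IsSmooth)
    (h' : ψ.IsSmooth) : DForm.nabla θ (φ - ψ) = DForm.nabla θ φ - DForm.nabla θ ψ := by
  rw [eq_sub_iff_add_eq, ← DForm.nabla_add θ (h.sub h') h', sub_add_cancel]

variable [IsManifold 𝓘(ℝ, RModel d) ∞ M]

lemma mdifferentiableAt_extChartAt_symm {x₀ : M} {y : RModel d}
    (hy : y ∈ (extChartAt 𝓘(ℝ, RModel d) x₀).target) :
    MDifferentiableAt 𝓘(ℝ, RModel d) 𝓘(ℝ, RModel d) (extChartAt 𝓘(ℝ, RModel d) x₀).symm y := by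
  have : IsManifold 𝓘(ℝ, RModel d) 1 M := .of_le (n := ∞) (by simp)
  have h := mdifferentiableWithinAt_extChartAt_symm (I := 𝓘(ℝ, RModel d)) hy
  rwa [modelWithCornersSelf_coe, Set.range_id, mdifferentiableWithinAt_univ] at h

lemma chartInvDeriv_self (x : M) :
    chartInvDeriv d x (extChartAt 𝓘(ℝ, RModel d) x x) = .id ℝ (RModel d) := by
  have : IsManifold 𝓘(ℝ, RModel d) 1 M := .of_le (n := ∞) (by simp)
  have h := mfderivWithin_range_extChartAt_symm (I := 𝓘(ℝ, RModel d)) (x := x)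
  rw [modelWithCornersSelf_coe, Set.range_id, mfderivWithin_univ] at h
  exact h

lemma DForm.inChart_self {r : ℕ} (φ : DForm d M r) (x : M) :
    φ.inChart x (extChartAt 𝓘(ℝ, RModel d) x x) = φ x := by
  ext v
  rw [DForm.inChart, chartInvDeriv_self, extChartAt_to_inv]
  rfl

/-- The domain of the transition map from the chart at `x₀` to the chart at `x₁` is open. -/
lemma eventually_mem_transition {x₀ x₁ : M} {y : RModel d}
    (hy : y ∈ (extChartAt 𝓘(ℝ, RModel d) x₀).target)
    (hy' : (extChartAt 𝓘(ℝ, RModel d) x₀).symm y ∈ (extChartAt 𝓘(ℝ, RModel d) x₁).source) :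
    ∀ᶠ y' in 𝓝 y, y' ∈ (extChartAt 𝓘(ℝ, RModel d) x₀).target ∧
      (extChartAt 𝓘(ℝ, RModel d) x₀).symm y' ∈ (extChartAt 𝓘(ℝ, RModel d) x₁).source :=
  (Filter.eventually_of_mem (extChartAt_target_mem_nhds_of_mem hy) fun _ h => h).and
    ((mdifferentiableAt_extChartAt_symm hy).continuousAt.eventually
      ((isOpen_extChartAt_source x₁).mem_nhds hy'))

lemma contDiffAt_transition {x₀ x₁ : M} {y : RModel d}
    (hy : y ∈ (extChartAt 𝓘(ℝ, RModel d) x₀).target)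
    (hy' : (extChartAt 𝓘(ℝ, RModel d) x₀).symm y ∈ (extChartAt 𝓘(ℝ, RModel d) x₁).source) :
    ContDiffAt ℝ ∞ (extChartAt 𝓘(ℝ, RModel d) x₁ ∘ (extChartAt 𝓘(ℝ, RModel d) x₀).symm) y := by
  have h1 : ContMDiffAt 𝓘(ℝ, RModel d) 𝓘(ℝ, RModel d) ∞ (extChartAt 𝓘(ℝ, RModel d) x₁)
      ((extChartAt 𝓘(ℝ, RModel d) x₀).symm y) :=
    contMDiffAt_extChartAt' (by rwa [extChartAt_source] at hy')
  have h2 : ContMDiffAt 𝓘(ℝ, RModel d) 𝓘(ℝ, RModel d) ∞ (extChartAt 𝓘(ℝ, RModel d) x₀).symm y :=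
    (contMDiffOn_extChartAt_symm x₀).contMDiffAt (extChartAt_target_mem_nhds_of_mem hy)
  exact (h1.comp y h2).contDiffAt

lemma chartInvDeriv_comp_transition {x₀ x₁ : M} {y : RModel d}
    (hy : y ∈ (extChartAt 𝓘(ℝ, RModel d) x₀).target)
    (hy' : (extChartAt 𝓘(ℝ, RModel d) x₀).symm y ∈ (extChartAt 𝓘(ℝ, RModel d) x₁).source) :
    (chartInvDeriv d x₁ (extChartAt 𝓘(ℝ, RModel d) x₁
        ((extChartAt 𝓘(ℝ, RModel d) x₀).symm y))).comp
      (fderiv ℝ (extChartAt 𝓘(ℝ, RModel d) x₁ ∘ (extChartAt 𝓘(ℝ, RModel d) x₀).symm) y) =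
    chartInvDeriv d x₀ y := by
  set τ := extChartAt 𝓘(ℝ, RModel d) x₁ ∘ (extChartAt 𝓘(ℝ, RModel d) x₀).symm with hτ
  have h1 : (extChartAt 𝓘(ℝ, RModel d) x₁).symm ∘ τ =ᶠ[𝓝 y]
      (extChartAt 𝓘(ℝ, RModel d) x₀).symm := by
    filter_upwards [eventually_mem_transition hy hy'] with y' h
    exact (extChartAt 𝓘(ℝ, RModel d) x₁).left_inv h.2
  have h2 : MDifferentiableAt 𝓘(ℝ, RModel d) 𝓘(ℝ, RModel d) τ y :=
    ((contDiffAt_transition hy hy').differentiableAt (by simp)).mdifferentiableAt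
  have h3 := mfderiv_comp y (g := (extChartAt 𝓘(ℝ, RModel d) x₁).symm) (f := τ)
    (mdifferentiableAt_extChartAt_symm ((extChartAt 𝓘(ℝ, RModel d) x₁).map_source hy')) h2
  rw [h1.mfderiv_eq, mfderiv_eq_fderiv] at h3
  exact h3.symm

/-- The expressions of a form in two charts are related by the pullback under the transition
map. -/
lemma DForm.inChart_eq_pullback {r : ℕ} (φ : DForm d M r) {x₀ x₁ : M} {y : RModel d}
    (hy : y ∈ (extChartAt 𝓘(ℝ, RModel d) x₀).target)
    (hy' : (extChartAt 𝓘(ℝ, RModel d) x₀).symm y ∈ (extChartAt 𝓘(ℝ, RModel d) x₁).source) :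
    φ.inChart x₀ y = (φ.inChart x₁ ((extChartAt 𝓘(ℝ, RModel d) x₁ ∘
      (extChartAt 𝓘(ℝ, RModel d) x₀).symm) y)).compContinuousLinearMap
      (fderiv ℝ (extChartAt 𝓘(ℝ, RModel d) x₁ ∘ (extChartAt 𝓘(ℝ, RModel d) x₀).symm) y) := by
  ext v
  simp only [DForm.inChart, compContinuousLinearMap_apply, Function.comp_apply,
    ← chartInvDeriv_comp_transition hy hy', (extChartAt 𝓘(ℝ, RModel d) x₁).left_inv hy']
  rfl

/-- The exterior derivative on the manifold is the exterior derivative in every chart. -/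
lemma DForm.IsSmooth.inChart_extD {r : ℕ} {φ : DForm d M r} (h : φ.IsSmooth) {x₀ : M}
    {y : RModel d} (hy : y ∈ (extChartAt 𝓘(ℝ, RModel d) x₀).target) :
    φ.extD.inChart x₀ y = extDeriv (φ.inChart x₀) y := by
  set x₁ := (extChartAt 𝓘(ℝ, RModel d) x₀).symm y with hx₁
  have hy' : x₁ ∈ (extChartAt 𝓘(ℝ, RModel d) x₁).source := mem_extChartAt_source x₁
  have h1 : φ.inChart x₀ =ᶠ[𝓝 y] fun y => (φ.inChart x₁ ((extChartAt 𝓘(ℝ, RModel d) x₁ ∘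
      (extChartAt 𝓘(ℝ, RModel d) x₀).symm) y)).compContinuousLinearMap
      (fderiv ℝ (extChartAt 𝓘(ℝ, RModel d) x₁ ∘ (extChartAt 𝓘(ℝ, RModel d) x₀).symm) y) := by
    filter_upwards [eventually_mem_transition hy hy'] with y' h
    exact φ.inChart_eq_pullback h.1 h.2
  have h3 : DifferentiableAt ℝ (φ.inChart x₁) ((extChartAt 𝓘(ℝ, RModel d) x₁ ∘
      (extChartAt 𝓘(ℝ, RModel d) x₀).symm) y) := h.differentiableAt x₁
  rw [h1.extDeriv_eq, extDeriv_pullback h3 (contDiffAt_transition hy hy') minSmoothness_le_infty]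
  have h2 := chartInvDeriv_comp_transition hy hy'
  rw [← hx₁, chartInvDeriv_self, ContinuousLinearMap.id_comp] at h2
  rw [h2]
  rfl

lemma DForm.IsSmooth.extD {r : ℕ} {φ : DForm d M r} (h : φ.IsSmooth) : φ.extD.IsSmooth := by
  refine DForm.isSmooth_of_contDiffAt fun x₀ y hy => ?_
  have h1 := contDiffAt_extDeriv (h.contDiffAt hy)
  refine h1.congr_of_eventuallyEq ?_
  filter_upwards [extChartAt_target_mem_nhds_of_mem hy] with y' hy'
  exact h.inChart_extD hy'

lemma DForm.IsSmooth.extD_extD {r : ℕ} {φ : DForm d M r} (h : φ.IsSmooth) :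
    φ.extD.extD = 0 := by
  funext x
  have h1 : φ.extD.inChart x =ᶠ[𝓝 (extChartAt 𝓘(ℝ, RModel d) x x)]
      _root_.extDeriv (φ.inChart x) := by
    filter_upwards [extChartAt_target_mem_nhds_of_mem (mem_extChartAt_target x)] with y hy
    exact h.inChart_extD hy
  rw [DForm.extD, h1.extDeriv_eq, extDeriv_extDeriv_apply (h.contDiffAt (mem_extChartAt_target x))
    minSmoothness_le_infty]
  rfl

lemma DForm.IsSmooth.nabla {r : ℕ} {θ : DForm d M 1} {φ : DForm d M r} (hθ : θ.IsSmooth)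
    (hφ : φ.IsSmooth) : (DForm.nabla θ φ).IsSmooth :=
  hφ.extD.sub (hθ.wedge hφ)

/-- The product rule for the exterior product with a closed `1`-form. -/
lemma DForm.extD_wedge {r : ℕ} {θ : DForm d M 1} {φ : DForm d M r} (hθ : θ.IsSmooth)
    (hc : θ.extD = 0) (hφ : φ.IsSmooth) : (θ.wedge φ).extD = -θ.wedge φ.extD := by
  funext x
  have hx := mem_extChartAt_target (I := 𝓘(ℝ, RModel d)) x
  have hs := fderiv_oneFormCLM_symm (hθ.differentiableAt x) (congrFun hc x)
  rw [DForm.extD, funext (DForm.inChart_wedge θ φ x), extDeriv_wedge_of_symmetric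
    ((DForm.contDiffAt_oneFormCLM_inChart hθ hx).differentiableAt (by simp))
    (hφ.differentiableAt x) hs, DForm.neg_apply]
  have h1 : θ.inChart x (extChartAt 𝓘(ℝ, RModel d) x x) = θ x := by
    exact DForm.inChart_self θ x
  rw [h1]
  rfl

/-- The connection `∇ = d - θ ∧` is flat. -/
lemma DForm.nabla_nabla {r : ℕ} {θ : DForm d M 1} {φ : DForm d M r} (hθ : θ.IsSmooth)
    (hc : θ.extD = 0) (hφ : φ.IsSmooth) : DForm.nabla θ (DForm.nabla θ φ) = 0 := by
  simp only [DForm.nabla]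
  rw [DForm.extD_sub hφ.extD (hθ.wedge hφ), hφ.extD_extD, DForm.extD_wedge hθ hc hφ,
    DForm.wedge_sub, DForm.wedge_wedge]
  simp

end Charts

/-! ### The foliation in charts -/

section LocalSubmersion

variable {ι : Type*} {d n : ℕ} {M N : Type*}
  [TopologicalSpace M] [ChartedSpace (RModel d) M]
  [TopologicalSpace N] [ChartedSpace (CModel n) N]

/-- The real manifold underlying a complex manifold. -/
lemma isManifold_real_of_complex (n : ℕ) (N : Type*) [TopologicalSpace N]
    [ChartedSpace (CModel n) N] [IsManifold 𝓘(ℂ, CModel n) ω N] :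
    IsManifold 𝓘(ℝ, CModel n) ∞ N := by
  refine isManifold_of_contDiffOn _ _ _ fun e e' he he' => ?_
  have h := (mem_groupoid_of_pregroupoid.1
    (HasGroupoid.compatible (G := contDiffGroupoid ω 𝓘(ℂ, CModel n)) he he')).1
  exact (h.restrict_scalars ℝ).of_le le_top

/-- The derivative of a chart of a complex manifold is complex linear and injective. -/
lemma exists_complexLinear_mfderiv_extChartAt [IsManifold 𝓘(ℂ, CModel n) ω N] {p q : N}
    (hq : q ∈ (chartAt (CModel n) p).source) :
    ∃ L : CModel n →L[ℂ] CModel n, Function.Injective L ∧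
      ∀ v, mfderiv 𝓘(ℝ, CModel n) 𝓘(ℝ, CModel n) (extChartAt 𝓘(ℝ, CModel n) p) q v = L v := by
  have : IsManifold 𝓘(ℂ, CModel n) 1 N := .of_le (n := ω) le_top
  set L : CModel n →L[ℂ] CModel n :=
    mfderiv 𝓘(ℂ, CModel n) 𝓘(ℂ, CModel n) (extChartAt 𝓘(ℂ, CModel n) p) q
  have h : HasMFDerivAt 𝓘(ℂ, CModel n) 𝓘(ℂ, CModel n) (extChartAt 𝓘(ℂ, CModel n) p) q L :=
    (mdifferentiableAt_extChartAt hq).hasMFDerivAt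
  have h' : HasMFDerivAt 𝓘(ℝ, CModel n) 𝓘(ℝ, CModel n) (extChartAt 𝓘(ℝ, CModel n) p) q
      (L.restrictScalars ℝ) := ⟨h.1, h.2.restrictScalars ℝ⟩
  have hinv : L.IsInvertible := isInvertible_mfderiv_extChartAt (by rwa [extChartAt_source])
  exact ⟨L, hinv.injective, fun v => by rw [h'.mfderiv]; rfl⟩

namespace TransHolFoliation

variable (F : TransHolFoliation ι d n M N)

/-- The differentials of two submersions of the cocycle differ by a complex linear map. -/
lemma exists_dφ_eq {x : M} {i j : ι} (hi : x ∈ F.U i) (hj : x ∈ F.U j) :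
    ∃ T : CModel n →L[ℂ] CModel n, ∀ v, F.dφ j x v = T (F.dφ i x v) := by
  have hx : x ∈ F.U i ∩ F.U j := ⟨hi, hj⟩
  have hnhds : F.U i ∩ F.U j ∈ 𝓝 x := ((F.isOpen_U i).inter (F.isOpen_U j)).mem_nhds hx
  have hd : ∀ k, x ∈ F.U k → MDifferentiableAt 𝓘(ℝ, RModel d) 𝓘(ℝ, CModel n) (F.φ k) x :=
    fun k hk => (((F.smooth_φ k).contMDiffAt ((F.isOpen_U k).mem_nhds hk)).mdifferentiableAt
      (by simp))
  have hf := (F.holomorphic_f i j (F.φ i x) (Set.mem_image_of_mem _ hx)).hasMFDerivWithinAt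
  -- The derivative is taken within the image of the overlap, where `f i j` is given to be
  -- holomorphic; that this image is open is not needed.
  set T : CModel n →L[ℂ] CModel n := mfderivWithin 𝓘(ℂ, CModel n) 𝓘(ℂ, CModel n) (F.f i j)
    (F.φ i '' (F.U i ∩ F.U j)) (F.φ i x)
  have hf' : HasMFDerivWithinAt 𝓘(ℝ, CModel n) 𝓘(ℝ, CModel n) (F.f i j)
      (F.φ i '' (F.U i ∩ F.U j)) (F.φ i x) (T.restrictScalars ℝ) :=
    ⟨hf.1, hf.2.restrictScalars ℝ⟩
  have h1 := HasMFDerivWithinAt.comp x hf' ((hd i hi).hasMFDerivAt.hasMFDerivWithinAt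
    (s := F.U i ∩ F.U j)) (Set.subset_preimage_image _ _)
  have h2 := h1.hasMFDerivAt hnhds
  have h3 : F.f i j ∘ F.φ i =ᶠ[𝓝 x] F.φ j := by
    filter_upwards [hnhds] with x' hx'
    exact (F.cocycle i j x' hx').symm
  have h4 := h2.mfderiv
  rw [h3.mfderiv_eq] at h4
  exact ⟨T, fun v => DFunLike.congr_fun h4 v⟩

lemma dφ_smul_iff {x : M} {i j : ι} (hi : x ∈ F.U i) (hj : x ∈ F.U j) {z : ℂ} {v w : RModel d}
    (h : F.dφ i x w = z • F.dφ i x v) : F.dφ j x w = z • F.dφ j x v := by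
  obtain ⟨T, hT⟩ := F.exists_dφ_eq hi hj
  rw [hT, hT, h, map_smul]

lemma mem_tangent_iff {x : M} {i : ι} (hi : x ∈ F.U i) {v : RModel d} :
    v ∈ F.tangent x ↔ F.dφ i x v = 0 := by
  simp only [tangent, Submodule.mem_iInf, LinearMap.mem_ker]
  refine ⟨fun h => h i hi, fun h j hj => ?_⟩
  have := F.dφ_smul_iff (z := 0) (v := 0) hi hj (by simpa using h)
  simpa using this

/-- In a chart of `M`, the foliation is given near every point by a submersion to the model space,
whose derivative carries the complex structure of the normal bundle to multiplication by scalars. -/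
lemma exists_local_submersion [IsManifold 𝓘(ℝ, RModel d) ∞ M] [IsManifold 𝓘(ℂ, CModel n) ω N]
    {x₀ : M} {y : RModel d} (hy : y ∈ (extChartAt 𝓘(ℝ, RModel d) x₀).target) :
    ∃ g : RModel d → CModel n, ContDiffAt ℝ ∞ g y ∧ Function.Surjective (fderiv ℝ g y) ∧
      ∀ᶠ y' in 𝓝 y, ∀ i, (extChartAt 𝓘(ℝ, RModel d) x₀).symm y' ∈ F.U i → ∀ (z : ℂ) u u',
        (fderiv ℝ g y' u' = z • fderiv ℝ g y' u ↔
          F.dφ i ((extChartAt 𝓘(ℝ, RModel d) x₀).symm y') (chartInvDeriv d x₀ y' u') =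
            z • F.dφ i ((extChartAt 𝓘(ℝ, RModel d) x₀).symm y') (chartInvDeriv d x₀ y' u)) := by
  have := isManifold_real_of_complex n N
  set e := (extChartAt 𝓘(ℝ, RModel d) x₀).symm with he
  set i₀ := F.idx (e y)
  have hi₀ : e y ∈ F.U i₀ := F.mem_idx _
  set q := F.φ i₀ (e y) with hq
  set g : RModel d → CModel n := extChartAt 𝓘(ℝ, CModel n) q ∘ (F.φ i₀ ∘ e) with hg
  have hes : ContMDiffAt 𝓘(ℝ, RModel d) 𝓘(ℝ, RModel d) ∞ e y :=
    (contMDiffOn_extChartAt_symm x₀).contMDiffAt (extChartAt_target_mem_nhds_of_mem hy)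
  have hφs : ContMDiffAt 𝓘(ℝ, RModel d) 𝓘(ℝ, CModel n) ∞ (F.φ i₀) (e y) :=
    (F.smooth_φ i₀).contMDiffAt ((F.isOpen_U i₀).mem_nhds hi₀)
  have hcs : ContMDiffAt 𝓘(ℝ, CModel n) 𝓘(ℝ, CModel n) ∞ (extChartAt 𝓘(ℝ, CModel n) q) q :=
    contMDiffAt_extChartAt
  have hgs : ContDiffAt ℝ ∞ g y := (ContMDiffAt.comp y (g := extChartAt 𝓘(ℝ, CModel n) q) hcs
    (ContMDiffAt.comp y hφs hes)).contDiffAt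
  -- The chain rule, at all points near `y`.
  have key : ∀ᶠ y' in 𝓝 y, e y' ∈ F.U i₀ ∧ ∃ L : CModel n →L[ℂ] CModel n, Function.Injective L ∧
      ∀ u, fderiv ℝ g y' u = L (F.dφ i₀ (e y') (chartInvDeriv d x₀ y' u)) := by
    have h1 : ∀ᶠ y' in 𝓝 y, e y' ∈ F.U i₀ :=
      hes.continuousAt.eventually ((F.isOpen_U i₀).mem_nhds hi₀)
    have h2 : ∀ᶠ y' in 𝓝 y, F.φ i₀ (e y') ∈ (chartAt (CModel n) q).source :=
      (ContinuousAt.comp (g := F.φ i₀) hφs.continuousAt hes.continuousAt).eventually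
        ((chartAt (CModel n) q).open_source.mem_nhds (mem_chart_source _ q))
    filter_upwards [h1, h2, extChartAt_target_mem_nhds_of_mem hy] with y' h1 h2 h3
    obtain ⟨L, hL, hL'⟩ := exists_complexLinear_mfderiv_extChartAt h2
    refine ⟨h1, L, hL, fun u => ?_⟩
    have : IsManifold 𝓘(ℝ, CModel n) 1 N := .of_le (n := ∞) (by simp)
    have hφd : MDifferentiableAt 𝓘(ℝ, RModel d) 𝓘(ℝ, CModel n) (F.φ i₀) (e y') :=
      ((F.smooth_φ i₀).contMDiffAt ((F.isOpen_U i₀).mem_nhds h1)).mdifferentiableAt (by simp)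
    have hed := mdifferentiableAt_extChartAt_symm h3
    have h4 : mfderiv 𝓘(ℝ, RModel d) 𝓘(ℝ, CModel n) g y' = _ :=
      mfderiv_comp y' (mdifferentiableAt_extChartAt (I := 𝓘(ℝ, CModel n)) h2)
        (MDifferentiableAt.comp y' hφd hed)
    rw [mfderiv_comp y' hφd hed, mfderiv_eq_fderiv] at h4
    rw [h4]
    exact hL' _
  refine ⟨g, hgs, ?_, ?_⟩
  · obtain ⟨-, L, hL, hL'⟩ := key.self_of_nhds
    have hC : Function.Surjective (chartInvDeriv d x₀ y) := by
      have : IsManifold 𝓘(ℝ, RModel d) 1 M := .of_le (n := ∞) (by simp)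
      have h := isInvertible_mfderivWithin_extChartAt_symm (I := 𝓘(ℝ, RModel d)) hy
      rw [modelWithCornersSelf_coe, Set.range_id, mfderivWithin_univ] at h
      exact h.surjective
    have hLs : Function.Surjective L :=
      LinearMap.surjective_of_injective (f := L.toLinearMap) hL
    intro c
    obtain ⟨a, rfl⟩ := hLs c
    obtain ⟨b, rfl⟩ := F.submersion_φ i₀ (e y) hi₀ a
    obtain ⟨u, rfl⟩ := hC b
    exact ⟨u, hL' u⟩
  · filter_upwards [key] with y' hy' i hi z u u'
    obtain ⟨h1, L, hL, hL'⟩ := hy'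
    rw [hL', hL', ← map_smul, hL.eq_iff]
    exact ⟨F.dφ_smul_iff h1 hi, F.dφ_smul_iff hi h1⟩

end TransHolFoliation
end LocalSubmersion

/-! ### The types of the components of the connection -/

section Types

variable {ι : Type*} {d n : ℕ} {M N : Type*}
  [TopologicalSpace M] [ChartedSpace (RModel d) M]
  [TopologicalSpace N] [ChartedSpace (CModel n) N]

namespace TransHolFoliation

variable {F : TransHolFoliation ι d n M N}

lemma isHorizontal_of_mem_ofType {p q r : ℕ} {φ : DForm d M r} (h : φ ∈ F.ofType p q r) :
    F.IsHorizontal φ := by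
  intro x v k hk
  have h1 := h x (F.idx x) (F.mem_idx x) 1 (Function.update v k 0) v fun j => by
    by_cases hj : j = k
    · subst hj; simpa using (F.mem_tangent_iff (F.mem_idx x)).1 hk
    · simp [hj]
  rw [h1, (φ x).map_coord_zero k (by simp), mul_zero]

/-- A horizontal form depends only on the classes of its arguments in the normal bundle. -/
lemma IsHorizontal.congr {r : ℕ} {φ : DForm d M r} (h : F.IsHorizontal φ) {x : M}
    {v w : Fin r → RModel d} (hvw : ∀ k, F.dφ (F.idx x) x (v k) = F.dφ (F.idx x) x (w k)) :
    φ x v = φ x w := by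
  -- The arguments are replaced one at a time.
  have key : ∀ s : Finset (Fin r), φ x (s.piecewise w v) = φ x v := by
    intro s
    induction s using Finset.induction_on with
    | empty => simp
    | insert k s hk ih =>
      rw [← ih, Finset.piecewise_insert, ← sub_eq_zero]
      have h1 := (φ x).toAlternatingMap.map_update_sub (s.piecewise w v) k (w k) (v k)
      have h2 : Function.update (s.piecewise w v) k (v k) = s.piecewise w v := by
        rw [Function.update_eq_self_iff]; simp [hk]
      rw [h2] at h1
      refine h1.symm.trans (h x _ k ?_)
      rw [Function.update_self, F.mem_tangent_iff (F.mem_idx x), map_sub, hvw, sub_self]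
  simpa using (key Finset.univ).symm

lemma dφ_liftJ (x : M) (v : RModel d) :
    F.dφ (F.idx x) x (F.liftJ x v) = Complex.I • F.dφ (F.idx x) x v :=
  (F.exists_lift x).choose_spec v

variable [IsManifold 𝓘(ℝ, RModel d) ∞ M] [IsManifold 𝓘(ℂ, CModel n) ω N]

variable (F) in
/-- Near a point of `M`, the foliation is given in the chart at that point by a submersion `g`, and
there is a parallel frame `V` for `g`. -/
lemma exists_local_submersion_frame (x : M) :
    ∃ (g : RModel d → CModel n) (V : RModel d → RModel d →L[ℝ] RModel d),
      ContDiffAt ℝ ∞ g (extChartAt 𝓘(ℝ, RModel d) x x) ∧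
      ContDiffAt ℝ ∞ V (extChartAt 𝓘(ℝ, RModel d) x x) ∧
      V (extChartAt 𝓘(ℝ, RModel d) x x) = .id ℝ (RModel d) ∧
      (∀ᶠ y in 𝓝 (extChartAt 𝓘(ℝ, RModel d) x x), (fderiv ℝ g y).comp (V y) =
        fderiv ℝ g (extChartAt 𝓘(ℝ, RModel d) x x)) ∧
      (∀ (z : ℂ) u u', (fderiv ℝ g (extChartAt 𝓘(ℝ, RModel d) x x) u' =
          z • fderiv ℝ g (extChartAt 𝓘(ℝ, RModel d) x x) u ↔
        F.dφ (F.idx x) x u' = z • F.dφ (F.idx x) x u)) ∧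
      ∀ᶠ y in 𝓝 (extChartAt 𝓘(ℝ, RModel d) x x), ∀ (z : ℂ) u u',
        F.dφ (F.idx x) x u' = z • F.dφ (F.idx x) x u →
          F.dφ (F.idx ((extChartAt 𝓘(ℝ, RModel d) x).symm y))
              ((extChartAt 𝓘(ℝ, RModel d) x).symm y) (chartInvDeriv d x y (V y u')) =
            z • F.dφ (F.idx ((extChartAt 𝓘(ℝ, RModel d) x).symm y))
              ((extChartAt 𝓘(ℝ, RModel d) x).symm y) (chartInvDeriv d x y (V y u)) := by
  obtain ⟨g, hg, hs, hgF⟩ := F.exists_local_submersion (mem_extChartAt_target x)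
  obtain ⟨V, hV, hVx, hpar⟩ := exists_parallel_frame hg hs
  have h0 : ∀ (z : ℂ) u u', (fderiv ℝ g (extChartAt 𝓘(ℝ, RModel d) x x) u' =
          z • fderiv ℝ g (extChartAt 𝓘(ℝ, RModel d) x x) u ↔
        F.dφ (F.idx x) x u' = z • F.dφ (F.idx x) x u) := by
    have h := hgF.self_of_nhds
    rw [extChartAt_to_inv, chartInvDeriv_self] at h
    exact h _ (F.mem_idx x)
  refine ⟨g, V, hg, hV, hVx, hpar, h0, ?_⟩
  filter_upwards [hgF, hpar] with y hy hy' z u u' h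
  rw [← hy _ (F.mem_idx _)]
  have h1 := DFunLike.congr_fun hy' u
  have h2 := DFunLike.congr_fun hy' u'
  rw [ContinuousLinearMap.comp_apply] at h1 h2
  rw [h1, h2, h0]
  exact h

/-- The exterior derivative of a horizontal form, computed by parallel vector fields. -/
lemma IsHorizontal.extD_apply {r : ℕ} {φ : DForm d M r} (hφ : F.IsHorizontal φ) (hs : φ.IsSmooth)
    {x : M} {g : RModel d → CModel n} {V : RModel d → RModel d →L[ℝ] RModel d}
    (hg : ContDiffAt ℝ ∞ g (extChartAt 𝓘(ℝ, RModel d) x x))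
    (hV : ContDiffAt ℝ ∞ V (extChartAt 𝓘(ℝ, RModel d) x x))
    (hVx : V (extChartAt 𝓘(ℝ, RModel d) x x) = .id ℝ (RModel d))
    (hpar : ∀ᶠ y in 𝓝 (extChartAt 𝓘(ℝ, RModel d) x x), (fderiv ℝ g y).comp (V y) =
        fderiv ℝ g (extChartAt 𝓘(ℝ, RModel d) x x))
    (hgF : ∀ (z : ℂ) u u', (fderiv ℝ g (extChartAt 𝓘(ℝ, RModel d) x x) u' =
          z • fderiv ℝ g (extChartAt 𝓘(ℝ, RModel d) x x) u ↔
        F.dφ (F.idx x) x u' = z • F.dφ (F.idx x) x u)) (v : Fin (r + 1) → RModel d) :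
    φ.extD x v = ∑ i : Fin (r + 1), (-1) ^ (i : ℕ) •
      fderiv ℝ (fun y => φ.inChart x y (fun k => V y (i.removeNth v k)))
        (extChartAt 𝓘(ℝ, RModel d) x x) (v i) := by
  refine extDeriv_apply_parallel hg hV hpar hVx (hs.differentiableAt x) (fun v k hk => ?_) v
  rw [DForm.inChart_self]
  refine hφ x v k ((F.mem_tangent_iff (F.mem_idx x)).2 ?_)
  have := (hgF 0 0 (v k)).1 (by simpa using hk)
  simpa using this

/-- If the arguments of a form `φ` of type `(p, q)` are multiplied by `z`, then each term of the
formula for `∇φ` in parallel vector fields has one argument in which a fixed linear functional is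
evaluated, and the others contribute the factor `z^p z̄^q`. -/
lemma exists_nabla_apply_eq (θ : DForm d M 1) {p q r : ℕ} {φ : DForm d M r} (hs : φ.IsSmooth)
    (hφ : φ ∈ F.ofType p q r) (x : M) (v : Fin (r + 1) → RModel d) :
    ∃ D : Fin (r + 1) → RModel d →L[ℝ] ℂ, ∀ (z : ℂ) (w : Fin (r + 1) → RModel d),
      (∀ k, F.dφ (F.idx x) x (w k) = z • F.dφ (F.idx x) x (v k)) →
      DForm.nabla θ φ x w = z ^ p * (starRingEnd ℂ z) ^ q * ∑ i, D i (w i) := by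
  obtain ⟨g, V, hg, hV, hVx, hpar, hgF, hVF⟩ := F.exists_local_submersion_frame x
  refine ⟨fun i => (-1 : ℂ) ^ (i : ℕ) •
    (fderiv ℝ (fun y => φ.inChart x y (fun k => V y (i.removeNth v k)))
      (extChartAt 𝓘(ℝ, RModel d) x x) - φ x (i.removeNth v) • oneFormCLM (RModel d) (θ x)),
    fun z w hw => ?_⟩
  have hw' : ∀ (i : Fin (r + 1)) k, F.dφ (F.idx x) x (i.removeNth w k) =
      z • F.dφ (F.idx x) x (i.removeNth v k) := fun i k => hw _
  have h1 : ∀ i : Fin (r + 1), φ x (i.removeNth w) =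
      z ^ p * (starRingEnd ℂ z) ^ q * φ x (i.removeNth v) := fun i =>
    hφ x (F.idx x) (F.mem_idx x) z _ _ (hw' i)
  have h2 : ∀ i : Fin (r + 1),
      fderiv ℝ (fun y => φ.inChart x y (fun k => V y (i.removeNth w k)))
        (extChartAt 𝓘(ℝ, RModel d) x x) = (z ^ p * (starRingEnd ℂ z) ^ q) •
      fderiv ℝ (fun y => φ.inChart x y (fun k => V y (i.removeNth v k)))
        (extChartAt 𝓘(ℝ, RModel d) x x) := by
    intro i
    have h3 : (fun y => φ.inChart x y (fun k => V y (i.removeNth w k)))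
        =ᶠ[𝓝 (extChartAt 𝓘(ℝ, RModel d) x x)] (z ^ p * (starRingEnd ℂ z) ^ q) •
          fun y => φ.inChart x y (fun k => V y (i.removeNth v k)) := by
      filter_upwards [hVF] with y hy
      exact hφ _ _ (F.mem_idx _) z _ _ fun k => hy z _ _ (hw' i k)
    rw [h3.fderiv_eq, fderiv_const_smul_field]
    rfl
  rw [DForm.nabla, DForm.sub_apply, ContinuousAlternatingMap.sub_apply, DForm.wedge_apply,
    (isHorizontal_of_mem_ofType hφ).extD_apply hs hg hV hVx hpar hgF, ← Finset.sum_sub_distrib,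
    Finset.mul_sum]
  refine Finset.sum_congr rfl fun i _ => ?_
  rw [h1, h2]
  simp
  ring

/-- The derivative `∇` of a form of type `(p, q)` is the sum of forms of types `(p + 1, q)` and
`(p, q + 1)`: this is the integrability of the transverse complex structure. With
`K(v₀, …, v_r) = ∇φ(J v₀, …, J v_r)`, the two forms are `(∇φ ± c K) / 2`, where
`c⁻¹ = i^p (-i)^q i` is the factor by which `K` differs from `∇φ` in type `(p + 1, q)`. -/
lemma exists_nabla_eq_add (θ : DForm d M 1) {p q r : ℕ} {φ : DForm d M r} (hs : φ.IsSmooth)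
    (hφ : φ ∈ F.ofType p q r) (hh : F.IsHorizontal (DForm.nabla θ φ)) :
    ∃ A ∈ F.ofType (p + 1) q (r + 1), ∃ B ∈ F.ofType p (q + 1) (r + 1),
      DForm.nabla θ φ = A + B := by
  set η := DForm.nabla θ φ with hη
  set K : DForm d M (r + 1) := fun x => (η x).compContinuousLinearMap (F.liftJ x) with hK
  set c : ℂ := (Complex.I ^ p * (-Complex.I) ^ q * Complex.I)⁻¹ with hc
  have hc0 : Complex.I ^ p * (-Complex.I) ^ q ≠ 0 := by simp
  -- The values on multiples of `v`, in terms of the values `S` and `T` on `v` and on `J v`.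
  have key : ∀ (x : M) (v : Fin (r + 1) → RModel d), ∃ S T : ℂ, ∀ (z : ℂ) w,
      (∀ k, F.dφ (F.idx x) x (w k) = z • F.dφ (F.idx x) x (v k)) →
      η x w = z ^ p * (starRingEnd ℂ z) ^ q * (z.re * S + z.im * T) ∧
      c * K x w = z ^ p * (starRingEnd ℂ z) ^ q * (-Complex.I * (-z.im * S + z.re * T)) := by
    intro x v
    obtain ⟨D, hD⟩ := exists_nabla_apply_eq θ hs hφ x v
    have h1 : ∀ (z : ℂ) w, (∀ k, F.dφ (F.idx x) x (w k) = z • F.dφ (F.idx x) x (v k)) →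
        η x w = z ^ p * (starRingEnd ℂ z) ^ q *
          (z.re * (∑ i, D i (v i)) + z.im * ∑ i, D i (F.liftJ x (v i))) := by
      intro z w hw
      rw [hh.congr (w := fun k => F.liftMul x z (v k)) fun k => by rw [hw, F.dφ_liftMul],
        hD z _ fun k => F.dφ_liftMul x z (v k), Finset.mul_sum Finset.univ _ (z.re : ℂ),
        Finset.mul_sum Finset.univ _ (z.im : ℂ), ← Finset.sum_add_distrib]
      congr 1
      refine Finset.sum_congr rfl fun i _ => ?_
      simp [liftMul]
    refine ⟨_, _, fun z w hw => ⟨h1 z w hw, ?_⟩⟩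
    have h2 := h1 (Complex.I * z) (fun k => F.liftJ x (w k)) fun k => by
      rw [dφ_liftJ, hw, smul_smul]
    have h3 : K x w = η x (fun k => F.liftJ x (w k)) := rfl
    rw [h3, h2, map_mul, Complex.conj_I, mul_pow, mul_pow, hc]
    simp only [Complex.mul_re, Complex.mul_im, Complex.I_re, Complex.I_im]
    have hI : (Complex.I)⁻¹ = -Complex.I := Complex.inv_I
    rw [mul_inv, hI]
    push_cast
    field_simp
    ring
  have hI2 := Complex.I_sq
  refine ⟨(1 / 2 : ℂ) • (η + c • K), ?_, (1 / 2 : ℂ) • (η - c • K), ?_, ?_⟩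
  · intro x i hx z v w hvw
    obtain ⟨S, T, h⟩ := key x v
    obtain ⟨h1, h2⟩ := h z w fun k => F.dφ_smul_iff hx (F.mem_idx x) (hvw k)
    obtain ⟨h3, h4⟩ := h 1 v fun k => by simp
    simp only [DForm.smul_apply, DForm.add_apply, ContinuousAlternatingMap.smul_apply,
      ContinuousAlternatingMap.add_apply, smul_eq_mul, h1, h2, h3, h4, pow_succ]
    simp
    linear_combination (1 / 2 * z ^ p * (starRingEnd ℂ z) ^ q * z.im * T) * hI2 +
      (1 / 2 * z ^ p * (starRingEnd ℂ z) ^ q * (S - Complex.I * T)) * Complex.re_add_im z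
  · intro x i hx z v w hvw
    obtain ⟨S, T, h⟩ := key x v
    obtain ⟨h1, h2⟩ := h z w fun k => F.dφ_smul_iff hx (F.mem_idx x) (hvw k)
    obtain ⟨h3, h4⟩ := h 1 v fun k => by simp
    have hz : starRingEnd ℂ z = z.re - z.im * Complex.I := by
      apply Complex.ext <;> simp
    simp only [DForm.smul_apply, DForm.sub_apply, ContinuousAlternatingMap.smul_apply,
      ContinuousAlternatingMap.sub_apply, smul_eq_mul, h1, h2, h3, h4, pow_succ]
    simp
    linear_combination (1 / 2 * z ^ p * (starRingEnd ℂ z) ^ q * z.im * T) * hI2 -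
      (1 / 2 * z ^ p * (starRingEnd ℂ z) ^ q * (S + Complex.I * T)) * hz
  · rw [← smul_add, add_add_sub_cancel, ← two_smul ℂ, smul_smul]
    norm_num

end TransHolFoliation
end Types

/-! ### Conjugation -/

section Conj

variable {d : ℕ} {M : Type*} [TopologicalSpace M] [ChartedSpace (RModel d) M]

/-- Complex conjugation of the values of alternating forms. -/
def conjAlt (E : Type*) [NormedAddCommGroup E] [NormedSpace ℝ E] (r : ℕ) :
    (E [⋀^Fin r]→L[ℝ] ℂ) →L[ℝ] E [⋀^Fin r]→L[ℝ] ℂ :=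
  ContinuousLinearMap.compContinuousAlternatingMapCLM ℝ E ℂ ℂ (Fin r) (Complex.conjCLE : ℂ →L[ℝ] ℂ)

lemma DForm.conj_apply {r : ℕ} (φ : DForm d M r) (x : M) (v : Fin r → RModel d) :
    φ.conj x v = starRingEnd ℂ (φ x v) := rfl

lemma DForm.conj_conj {r : ℕ} (φ : DForm d M r) : φ.conj.conj = φ := by
  ext x v; simp [DForm.conj_apply]

lemma DForm.conj_add {r : ℕ} (φ ψ : DForm d M r) : (φ + ψ).conj = φ.conj + ψ.conj := by
  ext x v; simp [DForm.conj_apply]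

lemma DForm.conj_sub {r : ℕ} (φ ψ : DForm d M r) : (φ - ψ).conj = φ.conj - ψ.conj := by
  ext x v; simp [DForm.conj_apply]

lemma DForm.conj_smul {r : ℕ} (c : ℂ) (φ : DForm d M r) :
    (c • φ).conj = starRingEnd ℂ c • φ.conj := by
  ext x v; simp [DForm.conj_apply]

lemma DForm.conj_zero {r : ℕ} : (0 : DForm d M r).conj = 0 := by
  ext x v; simp [DForm.conj_apply]

lemma DForm.IsSmooth.conj {r : ℕ} {φ : DForm d M r} (h : φ.IsSmooth) : φ.conj.IsSmooth := by
  refine DForm.isSmooth_of_contDiffAt fun x₀ y hy => ?_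
  have h1 := h.contDiffAt hy
  exact (conjAlt (RModel d) r).contDiff.contDiffAt.comp y h1

lemma DForm.extD_conj {r : ℕ} {φ : DForm d M r} (h : φ.IsSmooth) : φ.conj.extD = φ.extD.conj := by
  ext x v
  have h1 := (h.differentiableAt x).hasFDerivAt
  have h2 := (conjAlt (RModel d) r).hasFDerivAt.comp _ h1
  rw [DForm.conj_apply, DForm.extD, extDeriv, alternatizeUncurryFin_apply]
  rw [show fderiv ℝ (φ.conj.inChart x) (extChartAt 𝓘(ℝ, RModel d) x x) = _ from h2.fderiv,
    DForm.extD, extDeriv, alternatizeUncurryFin_apply, _root_.map_sum]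
  refine Finset.sum_congr rfl fun i _ => ?_
  rw [← Int.cast_smul_eq_zsmul ℂ, ← Int.cast_smul_eq_zsmul ℂ, smul_eq_mul, smul_eq_mul, map_mul]
  simp
  rfl

lemma DForm.conj_wedge {r : ℕ} (θ : DForm d M 1) (φ : DForm d M r) :
    (θ.wedge φ).conj = θ.conj.wedge φ.conj := by
  ext x v
  rw [DForm.conj_apply, DForm.wedge_apply, DForm.wedge_apply, _root_.map_sum]
  refine Finset.sum_congr rfl fun i _ => ?_
  rw [← Int.cast_smul_eq_zsmul ℂ, ← Int.cast_smul_eq_zsmul ℂ, smul_eq_mul, smul_eq_mul, map_mul]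
  simp [oneFormCLM_apply, DForm.conj_apply]

lemma DForm.nabla_conj {r : ℕ} {θ : DForm d M 1} (hreal : θ.conj = θ) {φ : DForm d M r}
    (h : φ.IsSmooth) : DForm.nabla θ φ.conj = (DForm.nabla θ φ).conj := by
  rw [DForm.nabla, DForm.nabla, DForm.conj_sub, DForm.conj_wedge, hreal, DForm.extD_conj h]

end Conj

section Foliation

variable {ι : Type*} {d n : ℕ} {M N : Type*}
  [TopologicalSpace M] [ChartedSpace (RModel d) M]
  [TopologicalSpace N] [ChartedSpace (CModel n) N]

namespace TransHolFoliation

variable {F : TransHolFoliation ι d n M N}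

lemma IsHorizontal.conj {r : ℕ} {φ : DForm d M r} (h : F.IsHorizontal φ) :
    F.IsHorizontal φ.conj := fun x v k hk => by
  rw [DForm.conj_apply, h x v k hk, _root_.map_zero]

lemma IsHorizontal.wedge {r : ℕ} {θ : DForm d M 1} {φ : DForm d M r} (hθ : F.IsHorizontal θ)
    (h : F.IsHorizontal φ) : F.IsHorizontal (θ.wedge φ) := fun x v k hk => by
  rw [DForm.wedge_apply]
  refine Finset.sum_eq_zero fun i _ => ?_
  by_cases hi : k = i
  · subst hi
    rw [oneFormCLM_apply, hθ x _ 0 hk, zero_mul, smul_zero]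
  · obtain ⟨j, rfl⟩ := Fin.exists_succAbove_eq hi
    rw [h x (i.removeNth v) j hk, mul_zero, smul_zero]

lemma IsHorizontal.sub {r : ℕ} {φ ψ : DForm d M r} (h : F.IsHorizontal φ)
    (h' : F.IsHorizontal ψ) : F.IsHorizontal (φ - ψ) := fun x v k hk => by
  simp [h x v k hk, h' x v k hk]

/-- The condition `i_X ∇φ = 0` on horizontal forms is equivalent to `i_X dφ = 0`, as `θ` is
horizontal. -/
lemma basicE_eq_basic {θ : DForm d M 1} (hθ : F.IsHorizontal θ) (r : ℕ) :
    F.basicE θ r = F.basic r := by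
  ext φ
  refine ⟨fun h => ⟨h.1, h.2.1, ?_⟩, fun h => ⟨h.1, h.2.1, h.2.2.sub (hθ.wedge h.2.1)⟩⟩
  rw [show φ.extD = DForm.nabla θ φ + θ.wedge φ by simp [DForm.nabla]]
  exact h.2.2.add (hθ.wedge h.2.1)

lemma conj_mem_ofType {p q r : ℕ} {φ : DForm d M r} (h : φ ∈ F.ofType p q r) :
    φ.conj ∈ F.ofType q p r := fun x i hx z v w hvw => by
  rw [DForm.conj_apply, DForm.conj_apply, h x i hx z v w hvw]
  simp only [map_mul, map_pow, Complex.conj_conj]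
  ring

lemma typeProj_conj (p q : ℕ) {r : ℕ} (φ : DForm d M r) :
    F.typeProj q p φ.conj = (F.typeProj p q φ).conj := by
  ext x v
  rw [DForm.conj_apply]
  simp only [typeProj, ContinuousAlternatingMap.smul_apply, ContinuousAlternatingMap.sum_apply,
    smul_eq_mul, ContinuousAlternatingMap.compContinuousLinearMap_apply, map_mul, _root_.map_sum,
    DForm.conj_apply, map_inv₀, map_pow, Complex.conj_conj]
  congr 1
  · simp [map_ofNat (starRingEnd ℂ)]
  · exact Finset.sum_congr rfl fun k _ => by ring

lemma conj_mem_basicEType {θ : DForm d M 1} (hreal : θ.conj = θ) {p q r : ℕ} {φ : DForm d M r}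
    (h : φ ∈ F.basicEType θ p q r) : φ.conj ∈ F.basicEType θ q p r := by
  refine ⟨⟨h.1.1.conj, h.1.2.1.conj, ?_⟩, conj_mem_ofType h.2⟩
  rw [DForm.nabla_conj hreal h.1.1]
  exact h.1.2.2.conj

lemma del_conj {θ : DForm d M 1} (hreal : θ.conj = θ) (p q : ℕ) {r : ℕ} {φ : DForm d M r}
    (h : φ.IsSmooth) : F.del θ q p φ.conj = (F.delbar θ p q φ).conj := by
  rw [del, delbar, DForm.nabla_conj hreal h, typeProj_conj]

lemma delbar_conj {θ : DForm d M 1} (hreal : θ.conj = θ) (p q : ℕ) {r : ℕ} {φ : DForm d M r}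
    (h : φ.IsSmooth) : F.delbar θ q p φ.conj = (F.del θ p q φ).conj := by
  rw [del, delbar, DForm.nabla_conj hreal h, typeProj_conj]

lemma conj_mem_antiholCocycles {θ : DForm d M 1} (hreal : θ.conj = θ) {q : ℕ} {φ : DForm d M q}
    (h : φ ∈ F.holCocycles θ q) : φ.conj ∈ F.antiholCocycles θ q :=
  ⟨conj_mem_basicEType hreal h.1, by rw [del_conj hreal 0 q h.1.1.1, h.2, DForm.conj_zero]⟩

lemma conj_mem_holCocycles {θ : DForm d M 1} (hreal : θ.conj = θ) {q : ℕ} {φ : DForm d M q}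
    (h : φ ∈ F.antiholCocycles θ q) : φ.conj ∈ F.holCocycles θ q :=
  ⟨conj_mem_basicEType hreal h.1, by rw [delbar_conj hreal q 0 h.1.1.1, h.2, DForm.conj_zero]⟩

lemma conj_mem_antiholCoboundaries {θ : DForm d M 1} (hreal : θ.conj = θ) {q : ℕ}
    {φ : DForm d M q} (h : φ ∈ F.holCoboundaries θ q) : φ.conj ∈ F.antiholCoboundaries θ q := by
  cases q with
  | zero =>
    rw [show φ = 0 from h, DForm.conj_zero]
    exact zero_mem _
  | succ q =>
    obtain ⟨ψ, hψ, rfl⟩ := h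
    exact ⟨ψ.conj, conj_mem_basicEType hreal hψ, del_conj hreal 0 q hψ.1.1⟩

lemma conj_mem_holCoboundaries {θ : DForm d M 1} (hreal : θ.conj = θ) {q : ℕ}
    {φ : DForm d M q} (h : φ ∈ F.antiholCoboundaries θ q) : φ.conj ∈ F.holCoboundaries θ q := by
  cases q with
  | zero =>
    rw [show φ = 0 from h, DForm.conj_zero]
    exact zero_mem _
  | succ q =>
    obtain ⟨ψ, hψ, rfl⟩ := h
    exact ⟨ψ.conj, conj_mem_basicEType hreal hψ, delbar_conj hreal q 0 hψ.1.1⟩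

/-- Conjugation of cocycles, a conjugate linear map. -/
def conjCocycles (F : TransHolFoliation ι d n M N) {θ : DForm d M 1} (hreal : θ.conj = θ) (q : ℕ) :
    F.holCocycles θ q →ₛₗ[starRingEnd ℂ] F.antiholCocycles θ q where
  toFun φ := ⟨φ.1.conj, conj_mem_antiholCocycles hreal φ.2⟩
  map_add' φ ψ := Subtype.ext (DForm.conj_add φ.1 ψ.1)
  map_smul' c φ := Subtype.ext (DForm.conj_smul c φ.1)

/-- Conjugation on cohomology, as a conjugate linear map. -/
def conjCohomology (F : TransHolFoliation ι d n M N) {θ : DForm d M 1} (hreal : θ.conj = θ)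
    (q : ℕ) : F.HolCohomology θ q →ₛₗ[starRingEnd ℂ] F.AntiholCohomology θ q :=
  Submodule.mapQ _ _ (F.conjCocycles hreal q) fun _ h => conj_mem_antiholCoboundaries hreal h

lemma conjCohomology_bijective {θ : DForm d M 1} (hreal : θ.conj = θ) (q : ℕ) :
    Function.Bijective (F.conjCohomology hreal q) := by
  constructor
  · rw [injective_iff_map_eq_zero]
    intro u hu
    obtain ⟨φ, rfl⟩ := Submodule.Quotient.mk_surjective _ u
    have h1 : F.conjCocycles hreal q φ ∈
        (F.antiholCoboundaries θ q).submoduleOf (F.antiholCocycles θ q) :=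
      (Submodule.Quotient.mk_eq_zero _).1 hu
    have h2 : φ.1.conj.conj ∈ F.holCoboundaries θ q := conj_mem_holCoboundaries hreal h1
    rw [DForm.conj_conj] at h2
    exact (Submodule.Quotient.mk_eq_zero _).2 h2
  · intro u
    obtain ⟨φ, rfl⟩ := Submodule.Quotient.mk_surjective _ u
    refine ⟨cohClass φ.1.conj (conj_mem_holCocycles hreal φ.2), ?_⟩
    exact congrArg Submodule.Quotient.mk (Subtype.ext (DForm.conj_conj φ.1))

/-- The isomorphism `κ` of the conjugate of `H^q(M/F, 𝓔)` with the cohomology of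
`(Ω^{•,0}(M/F, E), ∂_E)` that is given by conjugation. -/
def conjEquiv (F : TransHolFoliation ι d n M N) {θ : DForm d M 1} (hreal : θ.conj = θ) (q : ℕ) :
    ConjSpace (F.HolCohomology θ q) ≃ₗ[ℂ] F.AntiholCohomology θ q :=
  LinearEquiv.ofBijective
    ({ toFun := F.conjCohomology hreal q
       map_add' := (F.conjCohomology hreal q).map_add
       map_smul' := fun c u => by
         have h := (F.conjCohomology hreal q).map_smulₛₗ (starRingEnd ℂ c) u
         rw [Complex.conj_conj] at h
         exact h } : ConjSpace (F.HolCohomology θ q) →ₗ[ℂ] F.AntiholCohomology θ q)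
    (conjCohomology_bijective hreal q)

/-! ### The decomposition of `∇` and of basic `1`-forms -/

variable [IsManifold 𝓘(ℝ, RModel d) ∞ M] [IsManifold 𝓘(ℂ, CModel n) ω N]

lemma del_mem_ofType_and_nabla_eq {θ : DForm d M 1} {p q r : ℕ} (hr : p + q = r) {φ : DForm d M r}
    (h : φ ∈ F.basicEType θ p q r) :
    F.del θ p q φ ∈ F.ofType (p + 1) q (r + 1) ∧ F.delbar θ p q φ ∈ F.ofType p (q + 1) (r + 1) ∧
      DForm.nabla θ φ = F.del θ p q φ + F.delbar θ p q φ := by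
  obtain ⟨A, hA, B, hB, hAB⟩ := exists_nabla_eq_add θ h.1.1 h.2 h.1.2.2
  have h1 : F.del θ p q φ = A := by
    rw [del, hAB, typeProj_add, F.typeProj_of_mem hA,
      F.typeProj_of_mem_ne (by omega) (by omega) (by omega) hB, add_zero]
  have h2 : F.delbar θ p q φ = B := by
    rw [delbar, hAB, typeProj_add, F.typeProj_of_mem hB,
      F.typeProj_of_mem_ne (by omega) (by omega) (by omega) hA, zero_add]
  rw [h1, h2]
  exact ⟨hA, hB, hAB⟩

lemma del_mem_ofType {θ : DForm d M 1} {p q r : ℕ} (hr : p + q = r) {φ : DForm d M r}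
    (h : φ ∈ F.basicEType θ p q r) : F.del θ p q φ ∈ F.ofType (p + 1) q (r + 1) :=
  (del_mem_ofType_and_nabla_eq hr h).1

lemma delbar_mem_ofType {θ : DForm d M 1} {p q r : ℕ} (hr : p + q = r) {φ : DForm d M r}
    (h : φ ∈ F.basicEType θ p q r) : F.delbar θ p q φ ∈ F.ofType p (q + 1) (r + 1) :=
  (del_mem_ofType_and_nabla_eq hr h).2.1

lemma nabla_eq_del_add_delbar {θ : DForm d M 1} {p q r : ℕ} (hr : p + q = r) {φ : DForm d M r}
    (h : φ ∈ F.basicEType θ p q r) : DForm.nabla θ φ = F.del θ p q φ + F.delbar θ p q φ :=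
  (del_mem_ofType_and_nabla_eq hr h).2.2

/-- The components of `∇φ` other than `∂φ` and `∂̄φ` vanish. -/
lemma typeProj_nabla_eq_zero {θ : DForm d M 1} {p q r : ℕ} (hr : p + q = r) {φ : DForm d M r}
    (h : φ ∈ F.basicEType θ p q r) {a b : ℕ} (hab : a + b = r + 1) (h1 : p + 1 ≠ a) (h2 : p ≠ a) :
    F.typeProj a b (DForm.nabla θ φ) = 0 := by
  rw [nabla_eq_del_add_delbar hr h, typeProj_add,
    F.typeProj_of_mem_ne (by omega) hab h1 (del_mem_ofType hr h),
    F.typeProj_of_mem_ne (by omega) hab h2 (delbar_mem_ofType hr h), add_zero]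

/-- The composition of a `1`-form with the complex structure of the normal bundle. The form is
evaluated on a pointwise lift of that structure which need not depend continuously on the point;
on horizontal forms the choice is immaterial. -/
def compJ (F : TransHolFoliation ι d n M N) (ψ : DForm d M 1) : DForm d M 1 :=
  fun x => (ψ x).compContinuousLinearMap (F.liftJ x)

lemma compJ_apply (ψ : DForm d M 1) (x : M) (v : Fin 1 → RModel d) :
    F.compJ ψ x v = ψ x (fun k => F.liftJ x (v k)) := rfl

lemma IsHorizontal.compJ_apply_eq {ψ : DForm d M 1} (h : F.IsHorizontal ψ) {x : M}
    {v w : Fin 1 → RModel d}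
    (hvw : ∀ k, F.dφ (F.idx x) x (w k) = Complex.I • F.dφ (F.idx x) x (v k)) :
    F.compJ ψ x v = ψ x w :=
  h.congr fun k => (dφ_liftJ x (v k)).trans (hvw k).symm

lemma IsHorizontal.compJ {ψ : DForm d M 1} (h : F.IsHorizontal ψ) :
    F.IsHorizontal (F.compJ ψ) := fun x v k hk => by
  rw [h.compJ_apply_eq (w := 0) fun j => ?_, (ψ x).map_coord_zero 0 rfl]
  rw [Subsingleton.elim j k, (F.mem_tangent_iff (F.mem_idx x)).1 hk]
  simp

/-- A horizontal form may be composed with a smooth local lift of the complex structure instead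
of the pointwise one. -/
lemma IsHorizontal.isSmooth_compJ {ψ : DForm d M 1} (h : F.IsHorizontal ψ) (hs : ψ.IsSmooth) :
    (F.compJ ψ).IsSmooth := by
  refine DForm.isSmooth_of_contDiffAt fun x₀ y hy => ?_
  obtain ⟨g, hg, hgs, hgF⟩ := F.exists_local_submersion hy
  obtain ⟨V, hV, hVx, hpar⟩ := exists_parallel_frame hg hgs
  obtain ⟨s, hs'⟩ := (fderiv ℝ g y).toLinearMap.exists_rightInverse_of_surjective
    (LinearMap.range_eq_top.2 hgs)
  have hsc : ∀ c, fderiv ℝ g y (s c) = c := LinearMap.congr_fun hs'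
  -- A smooth local lift of the complex structure.
  set S : CModel n →L[ℝ] RModel d :=
    LinearMap.toContinuousLinearMap (s ∘ₗ (Complex.I • LinearMap.id : CModel n →ₗ[ℝ] CModel n))
  set J : RModel d → RModel d →L[ℝ] RModel d := fun y' => (V y').comp (S.comp (fderiv ℝ g y'))
  have hJ : ContDiffAt ℝ ∞ J y :=
    hV.clm_comp (contDiffAt_const.clm_comp (hg.fderiv_right (m := ∞) (by simp)))
  have h1 := (DForm.contDiffAt_oneFormCLM_inChart hs hy).clm_comp hJ
  have h2 : ContDiffAt ℝ ∞ (fun y' => ofSubsingletonLIE (𝕜 := ℝ) (E := RModel d) (F := ℂ)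
      (0 : Fin 1) ((oneFormCLM (RModel d) (ψ.inChart x₀ y')).comp (J y'))) y :=
    (ofSubsingletonLIE (𝕜 := ℝ) (E := RModel d) (F := ℂ)
      (0 : Fin 1)).toContinuousLinearEquiv.contDiff.contDiffAt.comp y h1
  refine h2.congr_of_eventuallyEq ?_
  filter_upwards [hgF, hpar] with y' hy' hp
  ext v
  refine h.compJ_apply_eq fun k => ?_
  refine (hy' _ (F.mem_idx _) _ _ _).1 ?_
  have h3 : fderiv ℝ g y' (J y' (v 0)) = fderiv ℝ g y (s (Complex.I • fderiv ℝ g y' (v 0))) :=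
    DFunLike.congr_fun hp _
  rw [hsc] at h3
  rw [Subsingleton.elim k 0]
  exact h3

/-- If `dψ` is horizontal then so is the exterior derivative of `ψ ∘ J`: the formula in
parallel fields gives `d(ψ ∘ J)(u, v) = dψ(u, J v)` for `u` tangent to the leaf. -/
lemma IsHorizontal.extD_compJ {ψ : DForm d M 1} (h : F.IsHorizontal ψ) (hs : ψ.IsSmooth)
    (hd : F.IsHorizontal ψ.extD) : F.IsHorizontal (F.compJ ψ).extD := by
  intro x
  obtain ⟨g, V, hg, hV, hVx, hpar, hgF, hVF⟩ := F.exists_local_submersion_frame x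
  have e0 : ∀ (v : Fin 2 → RModel d) k, Fin.removeNth (0 : Fin 2) v k = v 1 := fun v k => by
    fin_cases k; rfl
  have e1 : ∀ (v : Fin 2 → RModel d) k, Fin.removeNth (1 : Fin 2) v k = v 0 := fun v k => by
    fin_cases k; rfl
  -- `D w` is the derivative of the value of `ψ` on the parallel field through `w`.
  set D : RModel d → RModel d →L[ℝ] ℂ := fun w => fderiv ℝ (fun y => ψ.inChart x y fun _ => V y w)
    (extChartAt 𝓘(ℝ, RModel d) x x) with hD
  have h1 : ∀ v, ψ.extD x v = D (v 1) (v 0) - D (v 0) (v 1) := by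
    intro v
    rw [h.extD_apply hs hg hV hVx hpar hgF, Fin.sum_univ_two]
    simp only [e0, e1]
    simp [hD, sub_eq_add_neg]
  have h2 : ∀ w, fderiv ℝ (fun y => (F.compJ ψ).inChart x y fun _ => V y w)
      (extChartAt 𝓘(ℝ, RModel d) x x) = D (F.liftJ x w) := by
    intro w
    refine Filter.EventuallyEq.fderiv_eq ?_
    filter_upwards [hVF] with y hy
    exact h.compJ_apply_eq fun _ => hy _ _ _ (dφ_liftJ x w)
  have h3 : ∀ v, (F.compJ ψ).extD x v = D (F.liftJ x (v 1)) (v 0) - D (F.liftJ x (v 0)) (v 1) := by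
    intro v
    rw [h.compJ.extD_apply (h.isSmooth_compJ hs) hg hV hVx hpar hgF, Fin.sum_univ_two, ← h2, ← h2]
    simp only [e0, e1]
    simp [sub_eq_add_neg]
  have h4 : ∀ w, F.dφ (F.idx x) x w = 0 → D w = 0 := by
    intro w hw
    rw [hD]
    have : (fun y => ψ.inChart x y fun _ => V y w) =ᶠ[𝓝 (extChartAt 𝓘(ℝ, RModel d) x x)]
        fun _ => 0 := by
      filter_upwards [hVF] with y hy
      refine h _ _ 0 ((F.mem_tangent_iff (F.mem_idx _)).2 ?_)
      have := hy 0 0 w (by simpa using hw)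
      simpa using this
    simp only [this.fderiv_eq, fderiv_fun_const, Pi.zero_apply]
  have hJ : ∀ w, F.dφ (F.idx x) x w = 0 → F.dφ (F.idx x) x (F.liftJ x w) = 0 := fun w hw => by
    rw [dφ_liftJ, hw, smul_zero]
  intro v k hk
  have hk' := (F.mem_tangent_iff (F.mem_idx x)).1 hk
  rw [h3]
  obtain rfl | rfl : k = 0 ∨ k = 1 := by fin_cases k <;> simp
  · have h5 := (h1 _).symm.trans (hd x ![v 0, F.liftJ x (v 1)] 0 hk)
    change D (F.liftJ x (v 1)) (v 0) - D (v 0) (F.liftJ x (v 1)) = 0 at h5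
    rw [h4 _ hk', _root_.zero_apply, sub_zero] at h5
    rw [h5, h4 _ (hJ _ hk'), _root_.zero_apply, sub_zero]
  · have h5 := (h1 _).symm.trans (hd x ![F.liftJ x (v 0), v 1] 1 hk)
    change D (v 1) (F.liftJ x (v 0)) - D (F.liftJ x (v 0)) (v 1) = 0 at h5
    rw [h4 _ hk', _root_.zero_apply, zero_sub, neg_eq_zero] at h5
    rw [h5, h4 _ (hJ _ hk'), _root_.zero_apply, sub_zero]

/-- A basic `1`-form `ψ` is the sum of the basic forms `(ψ - i ψ ∘ J) / 2` and `(ψ + i ψ ∘ J) / 2`,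
of types `(1, 0)` and `(0, 1)`. -/
lemma exists_basic_eq_add {ψ : DForm d M 1} (h : ψ ∈ F.basic 1) :
    ∃ A ∈ F.basic 1 ⊓ F.ofType 1 0 1, ∃ B ∈ F.basic 1 ⊓ F.ofType 0 1 1, ψ = A + B := by
  obtain ⟨hs, hh, hd⟩ := h
  have hK : F.compJ ψ ∈ F.basic 1 := ⟨hh.isSmooth_compJ hs, hh.compJ, hh.extD_compJ hs hd⟩
  have key : ∀ (x : M) (i : ι), x ∈ F.U i → ∀ (z : ℂ) (v w : Fin 1 → RModel d),
      (∀ k, F.dφ i x (w k) = z • F.dφ i x (v k)) →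
      ψ x w = z.re * ψ x v + z.im * F.compJ ψ x v ∧
      F.compJ ψ x w = -z.im * ψ x v + z.re * F.compJ ψ x v := by
    intro x i hx z v w hvw
    have h1 : ∀ (z : ℂ) (w : Fin 1 → RModel d),
        (∀ k, F.dφ (F.idx x) x (w k) = z • F.dφ (F.idx x) x (v k)) →
        ψ x w = z.re * ψ x v + z.im * F.compJ ψ x v := by
      intro z w hw
      rw [hh.congr (w := fun k => F.liftMul x z (v k)) fun k => by rw [hw, F.dφ_liftMul]]
      have e : ∀ u : Fin 1 → RModel d, ψ x u = oneFormCLM (RModel d) (ψ x) (u 0) := fun u =>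
        congrArg (ψ x) (funext fun k => by rw [Subsingleton.elim k 0])
      rw [compJ_apply, e, e v, e fun k => F.liftJ x (v k)]
      simp [liftMul]
    have hw := fun k => F.dφ_smul_iff hx (F.mem_idx x) (hvw k)
    refine ⟨h1 z w hw, ?_⟩
    rw [F.compJ_apply, h1 (Complex.I * z) _ fun k => by rw [dφ_liftJ, hw, smul_smul]]
    simp
  have hI2 := Complex.I_sq
  refine ⟨(1 / 2 : ℂ) • (ψ - Complex.I • F.compJ ψ), ⟨?_, ?_⟩,
    (1 / 2 : ℂ) • (ψ + Complex.I • F.compJ ψ), ⟨?_, ?_⟩, ?_⟩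
  · exact Submodule.smul_mem _ _ (sub_mem ⟨hs, hh, hd⟩ (Submodule.smul_mem _ _ hK))
  · intro x i hx z v w hvw
    obtain ⟨h1, h2⟩ := key x i hx z v w hvw
    simp only [DForm.smul_apply, DForm.sub_apply, ContinuousAlternatingMap.smul_apply,
      ContinuousAlternatingMap.sub_apply, smul_eq_mul, h1, h2]
    linear_combination (1 / 2 * z.im * F.compJ ψ x v) * hI2 +
      (1 / 2 * (ψ x v - Complex.I * F.compJ ψ x v)) * Complex.re_add_im z
  · exact Submodule.smul_mem _ _ (add_mem ⟨hs, hh, hd⟩ (Submodule.smul_mem _ _ hK))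
  · intro x i hx z v w hvw
    obtain ⟨h1, h2⟩ := key x i hx z v w hvw
    have hz : starRingEnd ℂ z = z.re - z.im * Complex.I := by
      apply Complex.ext <;> simp
    simp only [DForm.smul_apply, DForm.add_apply, ContinuousAlternatingMap.smul_apply,
      ContinuousAlternatingMap.add_apply, smul_eq_mul, h1, h2]
    linear_combination (1 / 2 * z.im * F.compJ ψ x v) * hI2 -
      (1 / 2 * (ψ x v + Complex.I * F.compJ ψ x v)) * hz
  · rw [← smul_add, sub_add_add_cancel, ← two_smul ℂ, smul_smul]
    norm_num

end TransHolFoliation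
end Foliation

/-! ### The maps in cohomology and exactness -/

section BottChern

lemma cohClass_add {V : Type*} [AddCommGroup V] [Module ℂ V] {Z B : Submodule ℂ V} {x y : V}
    (hx : x ∈ Z) (hy : y ∈ Z) :
    cohClass (B := B) x hx + cohClass y hy = cohClass (x + y) (add_mem hx hy) := rfl

lemma cohClass_eq_zero_iff {V : Type*} [AddCommGroup V] [Module ℂ V] {Z B : Submodule ℂ V} {x : V}
    (hx : x ∈ Z) : cohClass (B := B) x hx = 0 ↔ x ∈ B :=
  Submodule.Quotient.mk_eq_zero _

lemma exists_cohClass_eq {V : Type*} [AddCommGroup V] [Module ℂ V] {Z B : Submodule ℂ V}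
    (u : Z ⧸ B.submoduleOf Z) : ∃ (x : V) (hx : x ∈ Z), u = cohClass x hx := by
  obtain ⟨⟨x, hx⟩, rfl⟩ := Submodule.Quotient.mk_surjective _ u
  exact ⟨x, hx, rfl⟩

variable {ι : Type*} {d n : ℕ} {M N : Type*}
  [TopologicalSpace M] [ChartedSpace (RModel d) M]
  [TopologicalSpace N] [ChartedSpace (CModel n) N]
  [IsManifold 𝓘(ℝ, RModel d) ∞ M] [IsManifold 𝓘(ℂ, CModel n) ω N]

namespace TransHolFoliation

variable {F : TransHolFoliation ι d n M N} {θ : DForm d M 1}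

lemma nabla_eq_del {α : DForm d M 1} (hα : α ∈ F.holCocycles θ 1) :
    DForm.nabla θ α = F.del θ 0 1 α := by
  rw [nabla_eq_del_add_delbar rfl hα.1, hα.2, add_zero]

lemma nabla_eq_delbar {β : DForm d M 1} (hβ : β ∈ F.antiholCocycles θ 1) :
    DForm.nabla θ β = F.delbar θ 1 0 β := by
  rw [nabla_eq_del_add_delbar rfl hβ.1, hβ.2, zero_add]

lemma nabla_mem_bcCocycles (hs : θ.IsSmooth) (hc : θ.extD = 0) {α : DForm d M 1}
    (hα : α ∈ F.basicE θ 1) (ht : DForm.nabla θ α ∈ F.ofType 1 1 2) :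
    DForm.nabla θ α ∈ F.bcCocycles θ 1 1 2 := by
  have h := DForm.nabla_nabla hs hc hα.1
  refine ⟨⟨⟨hs.nabla hα.1, hα.2.2, ?_⟩, ht⟩, ?_, ?_⟩
  · rw [h]; exact isHorizontal_zero
  · rw [del, h, typeProj_zero]
  · rw [delbar, h, typeProj_zero]

lemma del_mem_bcCocycles (hs : θ.IsSmooth) (hc : θ.extD = 0) {α : DForm d M 1}
    (hα : α ∈ F.holCocycles θ 1) : F.del θ 0 1 α ∈ F.bcCocycles θ 1 1 2 := by
  rw [← nabla_eq_del hα]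
  refine nabla_mem_bcCocycles hs hc hα.1.1 ?_
  rw [nabla_eq_del hα]
  exact del_mem_ofType rfl hα.1

lemma delbar_mem_bcCocycles (hs : θ.IsSmooth) (hc : θ.extD = 0) {β : DForm d M 1}
    (hβ : β ∈ F.antiholCocycles θ 1) : F.delbar θ 1 0 β ∈ F.bcCocycles θ 1 1 2 := by
  rw [← nabla_eq_delbar hβ]
  refine nabla_mem_bcCocycles hs hc hβ.1.1 ?_
  rw [nabla_eq_delbar hβ]
  exact delbar_mem_ofType rfl hβ.1

lemma del_mem_bcCoboundaries {α : DForm d M 1} (hα : α ∈ F.holCocycles θ 1)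
    (h : α ∈ F.holCoboundaries θ 1) : F.del θ 0 1 α ∈ F.bcCoboundaries θ 1 1 2 := by
  obtain ⟨ψ, hψ, rfl⟩ := h
  exact ⟨ψ, hψ, _, hα.1, rfl, rfl⟩

/-- If one of `∂ψ`, `∂̄ψ` is a smooth basic form, then so is the other, as their sum is `∇ψ`. -/
lemma nabla_sub_mem_basicE (hs : θ.IsSmooth) (hc : θ.extD = 0) {ψ : DForm d M 0}
    (hψ : ψ ∈ F.basicE θ 0) {β : DForm d M 1} (hβ : β ∈ F.basicE θ 1) :
    DForm.nabla θ ψ - β ∈ F.basicE θ 1 := by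
  refine sub_mem ⟨hs.nabla hψ.1, hψ.2.2, ?_⟩ hβ
  rw [DForm.nabla_nabla hs hc hψ.1]
  exact isHorizontal_zero

/-- The form `∂̄∂ψ = -∂∂̄ψ` is a Bott-Chern coboundary. -/
lemma delbar_mem_bcCoboundaries (hs : θ.IsSmooth) (hc : θ.extD = 0) {β : DForm d M 1}
    (hβ : β ∈ F.antiholCocycles θ 1) (h : β ∈ F.antiholCoboundaries θ 1) :
    F.delbar θ 1 0 β ∈ F.bcCoboundaries θ 1 1 2 := by
  obtain ⟨ψ, hψ, rfl⟩ := h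
  have hχ : DForm.nabla θ ψ - F.del θ 0 0 ψ = F.delbar θ 0 0 ψ := by
    rw [nabla_eq_del_add_delbar rfl hψ, add_sub_cancel_left]
  have hχm : F.delbar θ 0 0 ψ ∈ F.basicEType θ 0 1 1 :=
    ⟨hχ ▸ nabla_sub_mem_basicE hs hc hψ.1 hβ.1.1, delbar_mem_ofType rfl hψ⟩
  have h1 : F.del θ 0 1 (F.delbar θ 0 0 ψ) = -F.delbar θ 1 0 (F.del θ 0 0 ψ) := by
    rw [del, ← hχ, DForm.nabla_sub θ (hs.nabla hψ.1.1) hβ.1.1.1, DForm.nabla_nabla hs hc hψ.1.1,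
      zero_sub, ← neg_one_smul ℂ, typeProj_smul, neg_one_smul, delbar]
  rw [← neg_neg (F.delbar θ 1 0 _), ← h1]
  exact neg_mem ⟨ψ, hψ, _, hχm, rfl, rfl⟩

lemma bcCocycles_le_lichCocycles (hθ : F.IsHorizontal θ) :
    F.bcCocycles θ 1 1 2 ≤ F.lichCocycles θ 2 := by
  intro η hη
  refine ⟨basicE_eq_basic hθ 2 ▸ hη.1.1, ?_⟩
  rw [nabla_eq_del_add_delbar rfl hη.1, hη.2.1, hη.2.2, add_zero]

/-- Since `∂̄∂̄ψ = 0`, the form `∂∂̄ψ` is `∇∂̄ψ`. -/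
lemma bcCoboundaries_le_lichCoboundaries (hθ : θ ∈ F.basic 1) (hc : θ.extD = 0) :
    F.bcCoboundaries θ 1 1 2 ≤ F.lichCoboundaries θ 2 := by
  rintro _ ⟨ψ, hψ, χ, hχ, hχψ, rfl⟩
  refine ⟨χ, basicE_eq_basic hθ.2.1 1 ▸ hχ.1, ?_⟩
  have h1 : DForm.nabla θ ψ - χ = F.del θ 0 0 ψ := by
    rw [hχψ, nabla_eq_del_add_delbar rfl hψ, add_sub_cancel_right]
  have hβ : F.del θ 0 0 ψ ∈ F.basicEType θ 1 0 1 :=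
    ⟨h1 ▸ nabla_sub_mem_basicE hθ.1 hc hψ.1 hχ.1, del_mem_ofType rfl hψ⟩
  have h2 : DForm.nabla θ χ = -DForm.nabla θ (F.del θ 0 0 ψ) := by
    rw [← h1, DForm.nabla_sub θ (hθ.1.nabla hψ.1.1) hχ.1.1, DForm.nabla_nabla hθ.1 hc hψ.1.1,
      zero_sub, neg_neg]
  have h3 : F.delbar θ 0 1 χ = 0 := by
    rw [delbar, h2, ← neg_one_smul ℂ, typeProj_smul,
      typeProj_nabla_eq_zero (a := 0) (b := 1 + 1) rfl hβ rfl (by norm_num) (by norm_num),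
      smul_zero]
  rw [nabla_eq_del_add_delbar rfl hχ, h3, add_zero]

/-- An exact form `∇ψ` of type `(1, 1)` is `∂α + ∂̄β`, where `α` and `β` are the parts of `ψ` of
types `(0, 1)` and `(1, 0)`: the parts of `∇ψ` of types `(0, 2)` and `(2, 0)` are `∂̄α` and `∂β`. -/
lemma exists_eq_del_add_delbar (hθ : F.IsHorizontal θ) {η : DForm d M 2}
    (ht : η ∈ F.ofType 1 1 2) (hη : η ∈ F.lichCoboundaries θ 2) :
    ∃ α ∈ F.holCocycles θ 1, ∃ β ∈ F.antiholCocycles θ 1,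
      η = F.del θ 0 1 α + F.delbar θ 1 0 β := by
  obtain ⟨ψ, hψ, rfl⟩ := hη
  obtain ⟨β, hβ, α, hα, rfl⟩ := exists_basic_eq_add hψ
  have hβ' : β ∈ F.basicEType θ 1 0 1 := ⟨(basicE_eq_basic hθ 1).symm ▸ hβ.1, hβ.2⟩
  have hα' : α ∈ F.basicEType θ 0 1 1 := ⟨(basicE_eq_basic hθ 1).symm ▸ hα.1, hα.2⟩
  have hsum := DForm.nabla_add θ hβ'.1.1 hα'.1.1
  have h1 : F.delbar θ 0 1 α = 0 := by
    have h := F.typeProj_of_mem_ne (a := 1) (b := 1) (p := 0) (q := 2) rfl rfl (by norm_num) ht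
    rwa [hsum, typeProj_add,
      typeProj_nabla_eq_zero (a := 0) (b := 2) rfl hβ' rfl (by norm_num) (by norm_num),
      zero_add] at h
  have h2 : F.del θ 1 0 β = 0 := by
    have h := F.typeProj_of_mem_ne (a := 1) (b := 1) (p := 2) (q := 0) rfl rfl (by norm_num) ht
    rwa [hsum, typeProj_add,
      typeProj_nabla_eq_zero (a := 2) (b := 0) rfl hα' rfl (by norm_num) (by norm_num),
      add_zero] at h
  refine ⟨α, ⟨hα', h1⟩, β, ⟨hβ', h2⟩, ?_⟩
  rw [hsum, nabla_eq_del ⟨hα', h1⟩, nabla_eq_delbar ⟨hβ', h2⟩, add_comm]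

/-- The map `[α] ↦ [∂α]`. -/
def delCohomology (F : TransHolFoliation ι d n M N) {θ : DForm d M 1} (hs : θ.IsSmooth)
    (hc : θ.extD = 0) : F.HolCohomology θ 1 →ₗ[ℂ] F.BCCohomology θ 1 1 2 :=
  Submodule.mapQ _ _
    { toFun := fun α : F.holCocycles θ 1 =>
        (⟨F.del θ 0 1 α.1, del_mem_bcCocycles hs hc α.2⟩ : F.bcCocycles θ 1 1 2)
      map_add' := fun α β => Subtype.ext (del_add 0 1 α.2.1.1.1 β.2.1.1.1)
      map_smul' := fun c α => Subtype.ext (del_smul 0 1 c α.2.1.1.1) }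
    fun α h => del_mem_bcCoboundaries α.2 h

/-- The map `[β] ↦ [∂̄β]`. -/
def delbarCohomology (F : TransHolFoliation ι d n M N) {θ : DForm d M 1} (hs : θ.IsSmooth)
    (hc : θ.extD = 0) : F.AntiholCohomology θ 1 →ₗ[ℂ] F.BCCohomology θ 1 1 2 :=
  Submodule.mapQ _ _
    { toFun := fun β : F.antiholCocycles θ 1 =>
        (⟨F.delbar θ 1 0 β.1, delbar_mem_bcCocycles hs hc β.2⟩ : F.bcCocycles θ 1 1 2)
      map_add' := fun α β => Subtype.ext (delbar_add 1 0 α.2.1.1.1 β.2.1.1.1)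
      map_smul' := fun c α => Subtype.ext (delbar_smul 1 0 c α.2.1.1.1) }
    fun β h => delbar_mem_bcCoboundaries hs hc β.2 h

/-- The tautological map `[η] ↦ [η]` from Bott-Chern to Lichnerowicz cohomology. -/
def bcToLich (F : TransHolFoliation ι d n M N) {θ : DForm d M 1} (hθ : θ ∈ F.basic 1)
    (hc : θ.extD = 0) : F.BCCohomology θ 1 1 2 →ₗ[ℂ] F.LichCohomology θ 2 :=
  Submodule.mapQ _ _
    (Submodule.inclusion (bcCocycles_le_lichCocycles hθ.2.1))
    fun _ h => bcCoboundaries_le_lichCoboundaries hθ hc h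

lemma delCohomology_cohClass (hs : θ.IsSmooth) (hc : θ.extD = 0) {α : DForm d M 1}
    (hα : α ∈ F.holCocycles θ 1) :
    F.delCohomology hs hc (cohClass α hα) =
      cohClass (F.del θ 0 1 α) (del_mem_bcCocycles hs hc hα) := rfl

/-- The map `[α] ↦ [∂̄ᾱ]` on the conjugate of `H¹(M/F, 𝓔)`. -/
def delbarConjCohomology (F : TransHolFoliation ι d n M N) {θ : DForm d M 1} (hs : θ.IsSmooth)
    (hc : θ.extD = 0) (hreal : θ.conj = θ) :
    ConjSpace (F.HolCohomology θ 1) →ₗ[ℂ] F.BCCohomology θ 1 1 2 :=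
  (F.delbarCohomology hs hc).comp (F.conjEquiv hreal 1).toLinearMap

lemma delbarConjCohomology_symm_cohClass (hs : θ.IsSmooth) (hc : θ.extD = 0)
    (hreal : θ.conj = θ) {β : DForm d M 1} (hβ : β ∈ F.antiholCocycles θ 1) :
    F.delbarConjCohomology hs hc hreal ((F.conjEquiv hreal 1).symm (cohClass β hβ)) =
      cohClass (F.delbar θ 1 0 β) (delbar_mem_bcCocycles hs hc hβ) := by
  rw [delbarConjCohomology, LinearMap.comp_apply, LinearEquiv.coe_coe,
    LinearEquiv.apply_symm_apply]
  rfl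

theorem exact_coprod_bcToLich (hθ : θ ∈ F.basic 1) (hc : θ.extD = 0) (hreal : θ.conj = θ) :
    Function.Exact ((F.delCohomology hθ.1 hc).coprod (F.delbarConjCohomology hθ.1 hc hreal))
      (F.bcToLich hθ hc) := by
  refine fun y => ⟨fun hy => ?_, ?_⟩
  · obtain ⟨η, hη, rfl⟩ := exists_cohClass_eq y
    obtain ⟨α, hα, β, hβ, rfl⟩ := exists_eq_del_add_delbar hθ.2.1 hη.1.2
      ((cohClass_eq_zero_iff (bcCocycles_le_lichCocycles hθ.2.1 hη)).1 hy)
    refine ⟨(cohClass α hα, (F.conjEquiv hreal 1).symm (cohClass β hβ)), ?_⟩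
    rw [LinearMap.coprod_apply, delCohomology_cohClass, delbarConjCohomology_symm_cohClass]
    rfl
  · rintro ⟨⟨u, v⟩, rfl⟩
    obtain ⟨α, hα, rfl⟩ := exists_cohClass_eq u
    obtain ⟨v, rfl⟩ := (F.conjEquiv hreal 1).symm.surjective v
    obtain ⟨β, hβ, rfl⟩ := exists_cohClass_eq v
    rw [LinearMap.coprod_apply, delCohomology_cohClass, delbarConjCohomology_symm_cohClass,
      cohClass_add]
    -- The sum `∂α + ∂̄β` is `∇(α + β)`.
    refine (cohClass_eq_zero_iff (bcCocycles_le_lichCocycles hθ.2.1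
      (add_mem (del_mem_bcCocycles hθ.1 hc hα) (delbar_mem_bcCocycles hθ.1 hc hβ)))).2 ?_
    refine ⟨α + β, add_mem (basicE_eq_basic hθ.2.1 1 ▸ hα.1.1)
      (basicE_eq_basic hθ.2.1 1 ▸ hβ.1.1), ?_⟩
    rw [DForm.nabla_add θ hα.1.1.1 hβ.1.1.1, nabla_eq_del hα, nabla_eq_delbar hβ]

end TransHolFoliation

end BottChern

end

theorem mainTheorem3 {ι : Type*} {d n : ℕ} {M N : Type*}
    [TopologicalSpace M] [ChartedSpace (RModel d) M] [IsManifold 𝓘(ℝ, RModel d) ∞ M]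
    [TopologicalSpace N] [ChartedSpace (CModel n) N] [IsManifold 𝓘(ℂ, CModel n) ω N]
    (F : TransHolFoliation ι d n M N)
    (θ : DForm d M 1) (hθ : θ ∈ F.basic 1) (hclosed : θ.extD = 0) (hreal : θ.conj = θ) :
    -- `κ` identifies the conjugate of `H¹(M/F, 𝓔)` with the cohomology of `(Ω^{•,0}(M/F, E), ∂_E)`
    ∃ (κ : ConjSpace (F.HolCohomology θ 1) ≃ₗ[ℂ] F.AntiholCohomology θ 1)
      (a : F.HolCohomology θ 1 →ₗ[ℂ] F.BCCohomology θ 1 1 2)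
      (b : ConjSpace (F.HolCohomology θ 1) →ₗ[ℂ] F.BCCohomology θ 1 1 2)
      (ν : F.BCCohomology θ 1 1 2 →ₗ[ℂ] F.LichCohomology θ 2),
      (∀ (α : DForm d M 1) (hα : α ∈ F.holCocycles θ 1),
        ∃ h : α.conj ∈ F.antiholCocycles θ 1,
          κ (ConjSpace.of (cohClass α hα)) = cohClass α.conj h) ∧
      (∀ (α : DForm d M 1) (hα : α ∈ F.holCocycles θ 1),
        ∃ h : F.del θ 0 1 α ∈ F.bcCocycles θ 1 1 2,
          a (cohClass α hα) = cohClass (F.del θ 0 1 α) h) ∧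
      (∀ (β : DForm d M 1) (hβ : β ∈ F.antiholCocycles θ 1),
        ∃ h : F.delbar θ 1 0 β ∈ F.bcCocycles θ 1 1 2,
          b (κ.symm (cohClass β hβ)) = cohClass (F.delbar θ 1 0 β) h) ∧
      (∀ (η : DForm d M 2) (hη : η ∈ F.bcCocycles θ 1 1 2),
        ∃ h : η ∈ F.lichCocycles θ 2, ν (cohClass η hη) = cohClass η h) ∧
      Function.Exact (a.coprod b) ν := by
  exact ⟨F.conjEquiv hreal 1, F.delCohomology hθ.1 hclosed,
    F.delbarConjCohomology hθ.1 hclosed hreal, F.bcToLich hθ hclosed,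
    fun α hα => ⟨TransHolFoliation.conj_mem_antiholCocycles hreal hα, rfl⟩,
    fun α hα => ⟨_, TransHolFoliation.delCohomology_cohClass hθ.1 hclosed hα⟩,
    fun β hβ => ⟨_, TransHolFoliation.delbarConjCohomology_symm_cohClass hθ.1 hclosed hreal hβ⟩,
    fun η hη => ⟨TransHolFoliation.bcCocycles_le_lichCocycles hθ.2.1 hη, rfl⟩,
    TransHolFoliation.exact_coprod_bcToLich hθ hclosed hreal⟩
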